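/- Setting. Let $\mathcal X\subset\mathbb R^{d}$ be compact, let $k$ be a measurable positive semidefinite kernel on $\mathcal X$ with $k(x,x)\le 1$ for all $x$, with reproducing kernel Hilbert space $\mathcal H_k$, and assume that every eigenfunction $\phi$ of the integral operator of $k$ on $L^2(\mathcal X,\mathrm dx)$ for a nonzero eigenvalue has zero mean, $\int_{\mathcal X}\phi(x)\,\mathrm dx=0$. Let $f\in\mathcal H_k$ with $\|f\|_k\le B$, let $x^\star\in\mathcal X$ be a maximizer of $f$, and let $\lambda>0$, $\delta\in(0,1]$. Write $s(a)=(1+e^{-a})^{-1}$, so $\dot s=s(1-s)$, and $$k^{\mathrm D}\big((x_1,x_1'),(x_2,x_2')\big)=k(x_1,x_2)+k(x_1',x_2')-k(x_1,x_2')-k(x_1',x_2),$$ with RKHS $\mathcal H_{k^{\mathrm D}}$. Since $|f(x)-f(x')|\le 2B$, put $\kappa=\sup_{|a|\le 2B}1/\dot s(a)$ and $L=\sup_{|a|\le 2B}\dot s(a)$. For pairs $z_1,\dots,z_n\in\mathcal X\times\mathcal X$ let $K_n=(k^{\mathrm D}(z_i,z_j))_{i,j}$, $k_n(z)=(k^{\mathrm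 D}(z_i,z))_i$, and $$\sigma^{\mathrm D}(z)^2=k^{\mathrm D}(z,z)-k_n(z)^\top(K_n+\lambda\kappa I)^{-1}k_n(z),\qquad \gamma^{\mathrm D}_n=\sup_{z_1,\dots,z_n}\tfrac12\log\det\big(I+(\lambda\kappa)^{-1}K_n\big),$$ $$\beta^{\mathrm D}_n(\delta)=4LB+2L\sqrt{\tfrac{2\kappa}{\lambda}\big(\gamma^{\mathrm D}_n+\log(1/\delta)\big)}.$$ Interaction. At step $t=1,2,\dots$ a pair $z_t=(x_t,x_t')$ is chosen, measurably with respect to the $\sigma$-algebra $\mathcal F_t$ of the information available before the feedback $y_t\in\{0,1\}$ is seen; $y_1,\dots,y_{t-1}$ are $\mathcal F_t$-measurable, and $\mathbb P(y_t=1\mid\mathcal F_t)=s(f(x_t)-f(x_t'))$. The dueling regret is $$R^{\mathrm D}(T)=\sum_{t=1}^T\tfrac12\big(s(f(x^\star)-f(x_t))+s(f(x^\star)-f(x_t'))-1\big).$$ MaxMinLCB. At step $t$, let $\sigma^{\mathrm D}_t$ be the width above for the $t-1$ earlier pairs, and let $h_t\in\mathcal H_{k^{\mathrm D}}$ be the estimate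 from the $t-1$ earlier observations: with $\hat h$ the minimizer of the loss $$\sum_{\tau<t}\Big(-y_\tau\log s(h(z_\tau))-(1-y_\tau)\log\big(1-s(h(z_\tau))\big)\Big)+\tfrac\lambda2\|h\|^2_{k^{\mathrm D}}$$ over $\mathcal H_{k^{\mathrm D}}$, $h_t$ is any minimizer of $\|g(h)-g(\hat h)\|_{V^{-1}}$ over $\|h\|_{k^{\mathrm D}}\le B$, where $g(h)=\sum_{\tau<t}s(h(z_\tau))\,k^{\mathrm D}(z_\tau,\cdot)+\lambda h$, $V=\sum_{\tau<t}k^{\mathrm D}(z_\tau,\cdot)\otimes k^{\mathrm D}(z_\tau,\cdot)+\lambda\kappa\,\mathrm{Id}$ and $\|u\|_{V^{-1}}^2=\langle u,V^{-1}u\rangle$ (so $h_t=\hat h$ whenever $\|\hat h\|_{k^{\mathrm D}}\le B$). With $$\mathrm{LCB}_t(x,x')=s(h_t(x,x'))-\beta^{\mathrm D}_t(\delta)\sigma^{\mathrm D}_t(x,x'),$$ $$\mathcal M_t=\{x\in\mathcal X:\ s(h_t(x,x'))+\beta^{\mathrm D}_t(\delta)\sigma^{\mathrm D}_t(x,x')\ge\tfrac12\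 \text{ for all }x'\in\mathcal X\},$$ the algorithm plays $x_t\in\arg\max_{x\in\mathcal M_t}\mathrm{LCB}_t(x,x'(x))$ and $x_t'=x'(x_t)$, where $x'(x)\in\arg\min_{x'\in\mathcal M_t}\mathrm{LCB}_t(x,x')$; ties are broken arbitrarily. Theorem. With $C_3=(8+2\kappa)/\sqrt{\log(1+4(\lambda\kappa)^{-1})}$, $$\mathbb P\Big(\forall\, T\ge 0:\ R^{\mathrm D}(T)\le C_3\,\beta^{\mathrm D}_T(\delta)\sqrt{T\gamma^{\mathrm D}_T}\Big)\ge 1-\delta,$$ and, as $T\to\infty$ with all other quantities fixed, $C_3\,\beta^{\mathrm D}_T(\delta)\sqrt{T\gamma^{\mathrm D}_T}=O\big(\gamma^{\mathrm D}_T\sqrt T\big)$. -/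

import Mathlib

namespace DuelingBandit

noncomputable section

open MeasureTheory ProbabilityTheory Filter
open scoped RealInnerProductSpace Topology

/-- `s'(a) = s(a) (1 - s(a))`, the derivative of the sigmoid `s(a) = 1 / (1 + exp (-a))`. -/
def sigmoidDeriv (a : ℝ) : ℝ := Real.sigmoid a * (1 - Real.sigmoid a)

/-- `κ = sup 1 / s'(a)` over the arguments `|a| ≤ R`. -/
def kappa (R : ℝ) : ℝ := sSup ((fun a => 1 / sigmoidDeriv a) '' Set.Icc (-R) R)

/-- `L = sup s'(a)` over the arguments `|a| ≤ R`. -/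
def lipConst (R : ℝ) : ℝ := sSup (sigmoidDeriv '' Set.Icc (-R) R)

section Kernel

variable {Z : Type*}

/-- The kernel matrix `K_n` of the points `z_1, …, z_n`. -/
def gram (K : Z → Z → ℝ) {n : ℕ} (z : Fin n → Z) : Matrix (Fin n) (Fin n) ℝ :=
  Matrix.of fun i j => K (z i) (z j)

/-- The posterior width `σ(w)`, with
`σ²(w) = K(w, w) - k_n(w)ᵀ (K_n + ρ I)⁻¹ k_n(w)` and `k_n(w) = (K(z_i, w))_i`. -/
def posteriorStd (K : Z → Z → ℝ) (ρ : ℝ) {n : ℕ} (z : Fin n → Z) (w : Z) : ℝ :=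
  √(K w w - (fun i => K (z i) w) ⬝ᵥ
    Matrix.mulVec (gram K z + ρ • (1 : Matrix (Fin n) (Fin n) ℝ))⁻¹ (fun i => K (z i) w))

/-- The information gain `γ_n = sup_{z_1, …, z_n} ½ log det (I + ρ⁻¹ K_n)`. -/
def infoGain (K : Z → Z → ℝ) (ρ : ℝ) (n : ℕ) : ℝ :=
  ⨆ z : Fin n → Z,
    (1 / 2) * Real.log (Matrix.det ((1 : Matrix (Fin n) (Fin n) ℝ) + ρ⁻¹ • gram K z))

/-- The exploration coefficient
`β_n(δ) = 4 L B + 2 L √((2 κ / lam) (γ_n + log (1 / δ)))`, where `κ`, `L` are taken over `|a| ≤ R`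
and `γ_n` is the information gain of `K` with `ρ = lam κ`. -/
def beta (K : Z → Z → ℝ) (lam B R δ : ℝ) (n : ℕ) : ℝ :=
  4 * lipConst R * B + 2 * lipConst R *
    √(2 * kappa R / lam * (infoGain K (lam * kappa R) n + Real.log (1 / δ)))

/-- `H` is the reproducing kernel Hilbert space of the real kernel `K`. -/
def IsRKHSOf (H : Type*) [NormedAddCommGroup H] [InnerProductSpace ℝ H] [CompleteSpace H]
    [RKHS ℝ H Z ℝ] (K : Z → Z → ℝ) : Prop :=
  ∀ z w : Z, RKHS.kernel H z w 1 = K z w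

end Kernel

section Estimator

variable {Z : Type*} {H : Type*} [NormedAddCommGroup H] [InnerProductSpace ℝ H] [CompleteSpace H]
  [RKHS ℝ H Z ℝ]

/-- The regularized negative log-likelihood of `h` for the data `(z_i, y_i)`, `i = 1, …, n`. -/
def logisticLoss (lam : ℝ) {n : ℕ} (z : Fin n → Z) (y : Fin n → ℝ) (h : H) : ℝ :=
  (∑ i, (-(y i) * Real.log (Real.sigmoid (h (z i)))
    - (1 - y i) * Real.log (1 - Real.sigmoid (h (z i))))) + lam / 2 * ‖h‖ ^ 2

/-- `g_n(h) = ∑ i, s(h(z_i)) K(z_i, ·) + lam h`. -/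
def gradMap (lam : ℝ) {n : ℕ} (z : Fin n → Z) (h : H) : H :=
  (∑ i, Real.sigmoid (h (z i)) • RKHS.kerFun H (z i) 1) + lam • h

variable (H) in
/-- `V_n = ∑ i, K(z_i, ·) ⊗ K(z_i, ·) + ρ I`, an operator on `H`. -/
def covOp (ρ : ℝ) {n : ℕ} (z : Fin n → Z) : H →L[ℝ] H :=
  (∑ i, InnerProductSpace.rankOne ℝ (RKHS.kerFun H (z i) 1) (RKHS.kerFun H (z i) 1))
    + ρ • ContinuousLinearMap.id ℝ H

/-- The norm `√⟪u, V_n⁻¹ u⟫`. -/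
def invCovNorm (ρ : ℝ) {n : ℕ} (z : Fin n → Z) (u : H) : ℝ :=
  √⟪u, (covOp H ρ z).inverse u⟫

/-- `h` is the estimate with norm bound `B`: it minimizes `‖g_n(h) - g_n(h₀)‖_{V_n⁻¹}` over the ball
of radius `B`, where `h₀` is the minimizer of the loss over the whole of `H`. If `‖h₀‖ ≤ B`, this
says that `h = h₀`. -/
def IsEstimate (lam B R : ℝ) {n : ℕ} (z : Fin n → Z) (y : Fin n → ℝ) (h : H) : Prop :=
  ∃ h₀ : H, (∀ h' : H, logisticLoss lam z y h₀ ≤ logisticLoss lam z y h') ∧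
    ‖h‖ ≤ B ∧
    ∀ h' : H, ‖h'‖ ≤ B →
      invCovNorm (lam * kappa R) z (gradMap lam z h - gradMap lam z h₀) ≤
        invCovNorm (lam * kappa R) z (gradMap lam z h' - gradMap lam z h₀)

end Estimator

section Dueling

variable {X : Type*}

/-- The dueling kernel `k^D` on pairs of actions. -/
def duelingKernel (k : X → X → ℝ) (z w : X × X) : ℝ :=
  k z.1 w.1 + k z.2 w.2 - k z.1 w.2 - k z.2 w.1

/-- The eigenfunctions (for nonzero eigenvalues) of the integral operator of `k` on `L²(ν)` have
mean zero. -/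
def ZeroMeanEigenfunctions [MeasurableSpace X] (ν : Measure X) (k : X → X → ℝ) : Prop :=
  ∀ (c : ℝ) (φ : X → ℝ), c ≠ 0 → MemLp φ 2 ν →
    (∀ᵐ x ∂ν, ∫ x', k x x' * φ x' ∂ν = c * φ x) → ∫ x, φ x ∂ν = 0

/-- The bound `|f(x) - f(x')| ≤ 2 B` on utility differences, for `‖f‖_k ≤ B` and `k(x, x) ≤ 1`. It
is the range over which the constants `κ` and `L` of the dueling problem are taken. -/
def duelingRange (B : ℝ) : ℝ := 2 * B

/-- `κ` of the dueling problem. -/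
def kappaD (B : ℝ) : ℝ := kappa (duelingRange B)

/-- `γ^D_T`. -/
def gammaD (k : X → X → ℝ) (lam B : ℝ) (T : ℕ) : ℝ :=
  infoGain (duelingKernel k) (lam * kappaD B) T

/-- `β^D_T(δ)`. -/
def betaD (k : X → X → ℝ) (lam B δ : ℝ) (T : ℕ) : ℝ :=
  beta (duelingKernel k) lam B (duelingRange B) δ T

/-- `C₃ = (8 + 2 κ) / √(log (1 + 4 (lam κ)⁻¹))`. -/
def C3 (lam B : ℝ) : ℝ :=
  (8 + 2 * kappaD B) / √(Real.log (1 + 4 * (lam * kappaD B)⁻¹))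

/-- The pair `p` solves the Stackelberg game with objective `F` on the action set `M`: there is a
response `r` of the Follower, minimizing `F x` for each `x ∈ M`, such that the Leader's action `p.1`
maximizes `F x (r x)`, and `p.2` is the response to `p.1`. -/
def IsStackelbergPair (F : X → X → ℝ) (M : Set X) (p : X × X) : Prop :=
  ∃ r : X → X, (∀ x ∈ M, r x ∈ M ∧ IsMinOn (F x) M (r x)) ∧
    p.1 ∈ M ∧ IsMaxOn (fun x => F x (r x)) M p.1 ∧ p.2 = r p.1

variable {HD : Type*} [NormedAddCommGroup HD] [InnerProductSpace ℝ HD] [CompleteSpace HD]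
  [RKHS ℝ HD (X × X) ℝ]

/-- The confidence width `β σ(x, x')` after observing the duels `z`. -/
def width (k : X → X → ℝ) (lam B b : ℝ) {n : ℕ} (z : Fin n → X × X) (x x' : X) : ℝ :=
  b * posteriorStd (duelingKernel k) (lam * kappaD B) z (x, x')

/-- The lower confidence bound on the probability that `x` is preferred over `x'`. -/
def lcb (k : X → X → ℝ) (lam B b : ℝ) {n : ℕ} (z : Fin n → X × X) (h : HD) (x x' : X) : ℝ :=
  Real.sigmoid (h (x, x')) - width k lam B b z x x'

/-- The set of plausible maximizers: no action is preferred over `x` beyond doubt. -/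
def plausibleSet (k : X → X → ℝ) (lam B b : ℝ) {n : ℕ} (z : Fin n → X × X) (h : HD) : Set X :=
  {x | ∀ x' : X, 1 / 2 ≤ Real.sigmoid (h (x, x')) + width k lam B b z x x'}

variable (HD) in
/-- The pairs `(x n, x' n)` are chosen by MaxMinLCB when the observed feedback is `y n`. Rounds are
numbered from `0`, so that round `n` is step `t = n + 1`; its estimate and widths come from the `n`
observations of the earlier rounds, and its exploration coefficient is `β^D_t(δ)`. -/
def IsMaxMinLCB (k : X → X → ℝ) (lam B δ : ℝ) (x x' : ℕ → X) (y : ℕ → ℝ) : Prop :=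
  ∀ n : ℕ, ∃ h : HD,
    IsEstimate lam B (duelingRange B) (fun i : Fin n => (x i, x' i)) (fun i : Fin n => y i) h ∧
    IsStackelbergPair
      (lcb k lam B (betaD k lam B δ (n + 1)) (fun i : Fin n => (x i, x' i)) h)
      (plausibleSet k lam B (betaD k lam B δ (n + 1)) (fun i : Fin n => (x i, x' i)) h)
      (x n, x' n)

/-- The preference feedback model with utility `f`. The σ-algebra `ℱ n` is the information available
when the pair of round `n` is chosen; given it, the binary feedback `y n` equals `1` with probability
`s(f(x n) - f(x' n))`. -/
structure IsPreferenceFeedback [MeasurableSpace X] {Ω : Type*} {mΩ : MeasurableSpace Ω}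
    (P : Measure Ω) (ℱ : Filtration ℕ mΩ) (f : X → ℝ) (x x' : ℕ → Ω → X) (y : ℕ → Ω → ℝ) :
    Prop where
  measurable_fst : ∀ n, Measurable[ℱ n] (x n)
  measurable_snd : ∀ n, Measurable[ℱ n] (x' n)
  measurable_feedback : ∀ n, Measurable[ℱ (n + 1)] (y n)
  binary : ∀ n ω, y n ω = 0 ∨ y n ω = 1
  prob_eq : ∀ n, P[y n | ℱ n] =ᵐ[P] fun ω => Real.sigmoid (f (x n ω) - f (x' n ω))

/-- The cumulative dueling regret `R^D(T)` against the action `xs`, where `x` is preferred over `x'`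
with probability `s(f(x) - f(x'))`. -/
def duelingRegret (f : X → ℝ) (xs : X) (x x' : ℕ → X) (T : ℕ) : ℝ :=
  ∑ n ∈ Finset.range T,
    (Real.sigmoid (f xs - f (x n)) + Real.sigmoid (f xs - f (x' n)) - 1) / 2

end Dueling

end

end DuelingBandit

namespace DuelingBandit

noncomputable section

open MeasureTheory ProbabilityTheory Filter
open scoped RealInnerProductSpace Topology

/-! On a single event of probability at least `1 - δ`, every estimate satisfies `|s(h_t(x, x')) -
s(f(x) - f(x'))| ≤ β_t σ_t(x, x')` for all pairs at all times; the regret bound on that event is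
deterministic.

Confidence. The utility difference lies in the dueling RKHS with norm at most `‖f‖`
(`exists_dueling_difference`), so the feedback is a logistic model there. The first-order condition
and the strong monotonicity of `gradMap` bound the estimation error by a regularization bias plus
`‖S_n‖` in the `V_n⁻¹` norm, where `S_n` is the accumulated noise
(`IsEstimate.abs_sigmoid_sub_le_beta`). The process `exp(½ ‖S_n‖²) / √det(I + ρ⁻¹ K_n)` is a
nonnegative supermartingale, and Ville's inequality controls it at all times at once
(`ofReal_le_measure_invCovNorm_noiseSum_le`). It is the method of mixtures, but no Gaussian measure
on the RKHS is needed: by Sherman–Morrison each increment is a one-dimensional Gaussian integral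
(`mixture_succ`, `bernoulli_mixtureFactor_le`).

Regret. The maximizer of `f` is plausible, the Follower minimizes the lower bound against it, and
both chosen actions are plausible. Hence neither the preference of `x*` over `x_t` nor that of `x_t`
over `x_t'` exceeds `1/2` by more than two widths, and subadditivity of `s - 1/2` on the positive
axis bounds the round by three widths (`IsStackelbergPair.regret_le`). The widths sum to order `√(T
γ_T)` by the elliptical potential argument (`sum_posteriorStd_le`). -/

/-! ### Scalar inequalities for the sigmoid -/

lemma sigmoidDeriv_pos (a : ℝ) : 0 < sigmoidDeriv a :=
  mul_pos (Real.sigmoid_pos a) (sub_pos.2 (Real.sigmoid_lt_one a))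

lemma continuous_sigmoidDeriv : Continuous sigmoidDeriv :=
  continuous_sigmoid.mul (continuous_const.sub continuous_sigmoid)

lemma le_lipConst {R a : ℝ} (ha : |a| ≤ R) : sigmoidDeriv a ≤ lipConst R :=
  le_csSup (isCompact_Icc.image continuous_sigmoidDeriv).bddAbove
    (Set.mem_image_of_mem _ (abs_le.1 ha))

lemma le_kappa {R a : ℝ} (ha : |a| ≤ R) : 1 / sigmoidDeriv a ≤ kappa R :=
  le_csSup (isCompact_Icc.image
    (continuous_const.div continuous_sigmoidDeriv fun a => (sigmoidDeriv_pos a).ne')).bddAbove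
    (Set.mem_image_of_mem (fun a => 1 / sigmoidDeriv a) (abs_le.1 ha))

lemma lipConst_nonneg (R : ℝ) : 0 ≤ lipConst R := by
  refine Real.sSup_nonneg ?_
  rintro _ ⟨a, -, rfl⟩
  exact (sigmoidDeriv_pos a).le

lemma four_le_kappa {R : ℝ} (hR : 0 ≤ R) : 4 ≤ kappa R := by
  refine le_trans (le_of_eq ?_) (le_kappa (a := 0) (by simpa using hR))
  norm_num [sigmoidDeriv]

lemma exists_sigmoid_sub_eq {R a b : ℝ} (ha : |a| ≤ R) (hb : |b| ≤ R) :
    ∃ c, |c| ≤ R ∧ Real.sigmoid a - Real.sigmoid b = sigmoidDeriv c * (a - b) := by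
  wlog hab : b ≤ a generalizing a b
  · obtain ⟨c, hc, h⟩ := this hb ha (le_of_not_ge hab)
    exact ⟨c, hc, by linarith⟩
  rcases hab.eq_or_lt with rfl | hlt
  · exact ⟨b, hb, by simp⟩
  obtain ⟨c, hc, h⟩ := exists_hasDerivAt_eq_slope Real.sigmoid sigmoidDeriv hlt
    continuous_sigmoid.continuousOn fun x _ => Real.hasDerivAt_sigmoid x
  rw [abs_le] at ha hb
  refine ⟨c, abs_le.2 ⟨by linarith [hc.1], by linarith [hc.2]⟩, ?_⟩
  rw [h, div_mul_cancel₀ _ (sub_pos.2 hlt).ne']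

lemma abs_sigmoid_sub_le {R a b : ℝ} (ha : |a| ≤ R) (hb : |b| ≤ R) :
    |Real.sigmoid a - Real.sigmoid b| ≤ lipConst R * |a - b| := by
  obtain ⟨c, hc, h⟩ := exists_sigmoid_sub_eq ha hb
  rw [h, abs_mul, abs_of_pos (sigmoidDeriv_pos c)]
  exact mul_le_mul_of_nonneg_right (le_lipConst hc) (abs_nonneg _)

lemma sq_sub_le_kappa_mul {R a b : ℝ} (ha : |a| ≤ R) (hb : |b| ≤ R) :
    (a - b) ^ 2 ≤ kappa R * ((Real.sigmoid a - Real.sigmoid b) * (a - b)) := by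
  obtain ⟨c, hc, h⟩ := exists_sigmoid_sub_eq ha hb
  have h1 := le_kappa hc
  rw [div_le_iff₀ (sigmoidDeriv_pos c)] at h1
  rw [h]
  nlinarith [mul_le_mul_of_nonneg_right h1 (sq_nonneg (a - b))]

/-- On the positive axis `s - 1/2` is concave and vanishes at `0`, hence is subadditive. With `u =
exp(-a)` and `v = exp(-b)` in `(0, 1]` the gap factors explicitly, with numerator `(1 - u)(1 - v)(1
- uv)`. -/
lemma sigmoid_add_le {a b : ℝ} (ha : 0 ≤ a) (hb : 0 ≤ b) :
    Real.sigmoid (a + b) + 1 / 2 ≤ Real.sigmoid a + Real.sigmoid b := by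
  have hu : Real.exp (-a) ≤ 1 := Real.exp_le_one_iff.2 (by linarith)
  have hv : Real.exp (-b) ≤ 1 := Real.exp_le_one_iff.2 (by linarith)
  rw [Real.sigmoid_def, Real.sigmoid_def, Real.sigmoid_def, neg_add, Real.exp_add]
  have hu0 := Real.exp_pos (-a)
  have hv0 := Real.exp_pos (-b)
  set u := Real.exp (-a)
  set v := Real.exp (-b)
  rw [← sub_nonneg]
  have : (1 + u)⁻¹ + (1 + v)⁻¹ - ((1 + u * v)⁻¹ + 1 / 2) =
      (1 - u) * (1 - v) * (1 - u * v) / (2 * (1 + u) * (1 + v) * (1 + u * v)) := by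
    field_simp
    ring
  rw [this]
  have huv : u * v ≤ 1 := mul_le_one₀ hu hv0.le hv
  have := mul_nonneg (mul_nonneg (sub_nonneg.2 hu) (sub_nonneg.2 hv)) (sub_nonneg.2 huv)
  positivity

/-- If the best action is preferred over an action, and that action over a second one, with
probability at most `1 / 2 + w`, then the dueling regret of the two actions is at most `3 / 2 w`. -/
lemma sigmoid_add_sigmoid_le {a b w : ℝ} (ha : 0 ≤ a) (hw : 0 ≤ w)
    (h₁ : Real.sigmoid a - 1 / 2 ≤ w) (h₂ : Real.sigmoid b - 1 / 2 ≤ w) :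
    (Real.sigmoid a + Real.sigmoid (a + b) - 1) / 2 ≤ 3 / 2 * w := by
  rcases le_total 0 b with hb | hb
  · linarith [sigmoid_add_le ha hb]
  · linarith [Real.sigmoid_le (show a + b ≤ a by linarith)]

/-! ### The regularized covariance operator and its inverse norm -/

section Covariance

variable {Z : Type*} {H : Type*} [NormedAddCommGroup H] [InnerProductSpace ℝ H] [CompleteSpace H]
  [RKHS ℝ H Z ℝ]

variable (H) in
/-- The kernel section `K(w, ·)` as an element of the reproducing kernel Hilbert space. -/
abbrev feature (w : Z) : H := RKHS.kerFun H w 1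

lemma inner_feature_left (w : Z) (h : H) : ⟪feature H w, h⟫ = h w := by
  rw [RKHS.kerFun_inner]; simp

lemma inner_feature_right (w : Z) (h : H) : ⟪h, feature H w⟫ = h w := by
  rw [RKHS.inner_kerFun]; simp

lemma IsRKHSOf.inner_feature {K : Z → Z → ℝ} (hK : IsRKHSOf H K) (z w : Z) :
    ⟪feature H z, feature H w⟫ = K z w := by
  rw [inner_feature_left, RKHS.kerFun_apply, hK]

lemma IsRKHSOf.symm {K : Z → Z → ℝ} (hK : IsRKHSOf H K) (z w : Z) : K z w = K w z := by
  rw [← hK.inner_feature, ← hK.inner_feature, real_inner_comm]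

lemma covOp_apply (ρ : ℝ) {n : ℕ} (z : Fin n → Z) (u : H) :
    covOp H ρ z u = (∑ i, u (z i) • feature H (z i)) + ρ • u := by
  simp only [covOp, add_apply, sum_apply,
    InnerProductSpace.rankOne_apply, inner_feature_left, smul_apply,
    ContinuousLinearMap.id_apply]

lemma inner_covOp (ρ : ℝ) {n : ℕ} (z : Fin n → Z) (u v : H) :
    ⟪u, covOp H ρ z v⟫ = (∑ i, u (z i) * v (z i)) + ρ * ⟪u, v⟫ := by
  simp only [covOp_apply, inner_add_right, inner_sum, inner_smul_right, inner_feature_right]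
  congr 1
  exact Finset.sum_congr rfl fun i _ => mul_comm _ _

lemma covOp_symm (ρ : ℝ) {n : ℕ} (z : Fin n → Z) (u v : H) :
    ⟪covOp H ρ z u, v⟫ = ⟪u, covOp H ρ z v⟫ := by
  rw [real_inner_comm, inner_covOp, inner_covOp, real_inner_comm]
  congr 1
  exact Finset.sum_congr rfl fun i _ => mul_comm _ _

lemma mul_norm_sq_le_inner_covOp (ρ : ℝ) {n : ℕ} (z : Fin n → Z) (u : H) :
    ρ * ‖u‖ ^ 2 ≤ ⟪u, covOp H ρ z u⟫ := by
  rw [inner_covOp, real_inner_self_eq_norm_sq]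
  have : 0 ≤ ∑ i, u (z i) * u (z i) := Finset.sum_nonneg fun i _ => mul_self_nonneg _
  linarith

variable {ρ : ℝ} (hρ : 0 < ρ)
include hρ

/-- `V_n` is symmetric and bounded below by `ρ > 0`. This makes `inverse` a genuine inverse rather
than its default value `0`. -/
lemma isInvertible_covOp {n : ℕ} (z : Fin n → Z) : (covOp H ρ z).IsInvertible := by
  have h : IsUnit (covOp H ρ z) := by
    refine ContinuousLinearMap.isUnit_of_forall_le_norm_inner_map _ (c := ⟨ρ, hρ.le⟩) hρ fun x => ?_
    rw [covOp_symm, mul_comm]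
    exact (mul_norm_sq_le_inner_covOp ρ z x).trans (le_abs_self _)
  obtain ⟨u, hu⟩ := h
  exact ⟨ContinuousLinearEquiv.unitsEquiv ℝ H u, by rw [← hu]; rfl⟩

lemma covOp_inverse_apply {n : ℕ} (z : Fin n → Z) (u : H) :
    covOp H ρ z ((covOp H ρ z).inverse u) = u :=
  (isInvertible_covOp hρ z).self_apply_inverse u

lemma inverse_covOp_apply {n : ℕ} (z : Fin n → Z) (u : H) :
    (covOp H ρ z).inverse (covOp H ρ z u) = u :=
  (isInvertible_covOp hρ z).inverse_apply_self u

lemma inner_inverse_symm {n : ℕ} (z : Fin n → Z) (u v : H) :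
    ⟪(covOp H ρ z).inverse u, v⟫ = ⟪u, (covOp H ρ z).inverse v⟫ := by
  conv_lhs => rw [← covOp_inverse_apply hρ z v]
  rw [← covOp_symm, covOp_inverse_apply hρ]

lemma inner_inverse_nonneg {n : ℕ} (z : Fin n → Z) (u : H) :
    0 ≤ ⟪u, (covOp H ρ z).inverse u⟫ := by
  have h := mul_norm_sq_le_inner_covOp ρ z ((covOp H ρ z).inverse u)
  rw [covOp_inverse_apply hρ, real_inner_comm] at h
  exact le_trans (by positivity) h

lemma inner_inverse_le {n : ℕ} (z : Fin n → Z) (u : H) :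
    ⟪u, (covOp H ρ z).inverse u⟫ ≤ ‖u‖ ^ 2 / ρ := by
  set x := (covOp H ρ z).inverse u with hx
  have h := mul_norm_sq_le_inner_covOp ρ z x
  rw [hx, covOp_inverse_apply hρ, ← hx, real_inner_comm] at h
  have h1 : ⟪u, x⟫ ≤ ‖u‖ * ‖x‖ := real_inner_le_norm u x
  rw [le_div_iff₀ hρ]
  nlinarith [sq_nonneg (ρ * ‖x‖ - ‖u‖), norm_nonneg u, norm_nonneg x]

lemma inner_inverse_sq_le {n : ℕ} (z : Fin n → Z) (u v : H) :
    ⟪u, (covOp H ρ z).inverse v⟫ ^ 2 ≤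
      ⟪u, (covOp H ρ z).inverse u⟫ * ⟪v, (covOp H ρ z).inverse v⟫ := by
  have h := LinearMap.BilinForm.apply_mul_apply_le_of_forall_zero_le
    ((innerₗ H).compl₂ ((covOp H ρ z).inverse : H →ₗ[ℝ] H))
    (fun u => inner_inverse_nonneg hρ z u) u v
  simp only [LinearMap.compl₂_apply, innerₗ_apply_apply, ContinuousLinearMap.coe_coe] at h
  rwa [← inner_inverse_symm hρ z v u, real_inner_comm u, ← sq] at h

lemma sq_invCovNorm {n : ℕ} (z : Fin n → Z) (u : H) :
    invCovNorm ρ z u ^ 2 = ⟪u, (covOp H ρ z).inverse u⟫ :=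
  Real.sq_sqrt (inner_inverse_nonneg hρ z u)

omit hρ in
lemma invCovNorm_nonneg {n : ℕ} (z : Fin n → Z) (u : H) : 0 ≤ invCovNorm ρ z u :=
  Real.sqrt_nonneg _

lemma abs_inner_inverse_le {n : ℕ} (z : Fin n → Z) (u v : H) :
    |⟪u, (covOp H ρ z).inverse v⟫| ≤ invCovNorm ρ z u * invCovNorm ρ z v := by
  refine abs_le_of_sq_le_sq ?_ (mul_nonneg (invCovNorm_nonneg z u) (invCovNorm_nonneg z v))
  rw [mul_pow, sq_invCovNorm hρ, sq_invCovNorm hρ]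
  exact inner_inverse_sq_le hρ z u v

lemma invCovNorm_sub_le {n : ℕ} (z : Fin n → Z) (u v : H) :
    invCovNorm ρ z (u - v) ≤ invCovNorm ρ z u + invCovNorm ρ z v := by
  refine le_of_sq_le_sq ?_ (add_nonneg (invCovNorm_nonneg z u) (invCovNorm_nonneg z v))
  have h1 := abs_inner_inverse_le hρ z u v
  have h2 := neg_abs_le ⟪u, (covOp H ρ z).inverse v⟫
  rw [sq_invCovNorm hρ, add_sq, sq_invCovNorm hρ, sq_invCovNorm hρ, map_sub, inner_sub_left,
    inner_sub_right, inner_sub_right, ← inner_inverse_symm hρ z v u,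
    real_inner_comm u ((covOp H ρ z).inverse v)]
  linarith

lemma invCovNorm_le {n : ℕ} (z : Fin n → Z) (u : H) :
    invCovNorm ρ z u ≤ ‖u‖ / √ρ := by
  refine Real.sqrt_le_iff.2 ⟨by positivity, ?_⟩
  rw [div_pow, Real.sq_sqrt hρ.le]
  exact inner_inverse_le hρ z u

end Covariance

/-! ### Rank-one updates, posterior variance and the determinant -/

section Posterior

variable {Z : Type*} {H : Type*} [NormedAddCommGroup H] [InnerProductSpace ℝ H] [CompleteSpace H]
  [RKHS ℝ H Z ℝ]

variable (H) in
/-- The operator `V_n` of the first `n` points of a sequence. -/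
def covSeq (ρ : ℝ) (z : ℕ → Z) (n : ℕ) : H →L[ℝ] H := covOp H ρ fun i : Fin n => z i

variable (H) in
/-- The normalized posterior covariance `⟪K(w, ·), V_n⁻¹ K(w', ·)⟫` given the first `n` points of a
sequence. -/
def postCov (ρ : ℝ) (z : ℕ → Z) (n : ℕ) (w w' : Z) : ℝ :=
  ⟪feature H w, (covSeq H ρ z n).inverse (feature H w')⟫

lemma covSeq_succ_apply (ρ : ℝ) (z : ℕ → Z) (n : ℕ) (u : H) :
    covSeq H ρ z (n + 1) u = covSeq H ρ z n u + u (z n) • feature H (z n) := by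
  simp only [covSeq, covOp_apply, Fin.sum_univ_castSucc, Fin.val_castSucc, Fin.val_last]
  abel

variable {ρ : ℝ} (hρ : 0 < ρ)
include hρ

lemma postCov_self_nonneg (z : ℕ → Z) (n : ℕ) (w : Z) : 0 ≤ postCov H ρ z n w w :=
  inner_inverse_nonneg hρ _ _

lemma postCov_self_le {K : Z → Z → ℝ} (hK : IsRKHSOf H K) (z : ℕ → Z) (n : ℕ) (w : Z) :
    postCov H ρ z n w w ≤ K w w / ρ := by
  have := inner_inverse_le hρ (fun i : Fin n => z i) (feature H w)
  rwa [← real_inner_self_eq_norm_sq, hK.inner_feature] at this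

lemma postCov_zero {K : Z → Z → ℝ} (hK : IsRKHSOf H K) (z : ℕ → Z) (w w' : Z) :
    postCov H ρ z 0 w w' = K w w' / ρ := by
  have h : (covSeq H ρ z 0).inverse (feature H w') = ρ⁻¹ • feature H w' := by
    have := inverse_covOp_apply hρ (fun i : Fin 0 => z i) (ρ⁻¹ • feature H w')
    rw [covOp_apply, Finset.univ_eq_empty, Finset.sum_empty, zero_add,
      smul_inv_smul₀ hρ.ne'] at this
    exact this
  rw [postCov, h, inner_smul_right, hK.inner_feature, inv_mul_eq_div]

/-- The Sherman–Morrison formula for `V_{n+1}⁻¹`. -/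
lemma covSeq_succ_inverse_apply (z : ℕ → Z) (n : ℕ) (u : H) :
    (covSeq H ρ z (n + 1)).inverse u = (covSeq H ρ z n).inverse u -
      (⟪feature H (z n), (covSeq H ρ z n).inverse u⟫ / (1 + postCov H ρ z n (z n) (z n))) •
        (covSeq H ρ z n).inverse (feature H (z n)) := by
  set c := ⟪feature H (z n), (covSeq H ρ z n).inverse u⟫ / (1 + postCov H ρ z n (z n) (z n)) with hc
  have hb : 0 < 1 + postCov H ρ z n (z n) (z n) := by
    linarith [postCov_self_nonneg (H := H) hρ z n (z n)]
  have h1 := covOp_inverse_apply hρ (fun i : Fin n => z i) u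
  have h2 := covOp_inverse_apply hρ (fun i : Fin n => z i) (feature H (z n))
  change covSeq H ρ z n _ = _ at h1
  change covSeq H ρ z n _ = _ at h2
  change covSeq H ρ z n ((covSeq H ρ z n).inverse _) = _ at h1
  change covSeq H ρ z n ((covSeq H ρ z n).inverse _) = _ at h2
  have key : covSeq H ρ z (n + 1) ((covSeq H ρ z n).inverse u -
      c • (covSeq H ρ z n).inverse (feature H (z n))) = u := by
    rw [covSeq_succ_apply, map_sub, map_smul, h1, h2, ← inner_feature_left, inner_sub_right,
      inner_smul_right]
    change u - c • feature H (z n) +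
      (_ - c * postCov H ρ z n (z n) (z n)) • feature H (z n) = u
    rw [sub_add, ← sub_smul, sub_eq_self]
    refine smul_eq_zero_of_left ?_ _
    rw [hc]
    field_simp
    ring
  have := inverse_covOp_apply hρ (fun i : Fin (n + 1) => z i) ((covSeq H ρ z n).inverse u -
      c • (covSeq H ρ z n).inverse (feature H (z n)))
  rw [← this]
  change _ = (covSeq H ρ z (n + 1)).inverse (covSeq H ρ z (n + 1) _)
  rw [key]

/-- Together with `postCov_zero` this computes the posterior covariance from `K` alone by finitely
many rational operations, which is how its measurability is proved. -/
lemma postCov_succ (z : ℕ → Z) (n : ℕ) (w w' : Z) :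
    postCov H ρ z (n + 1) w w' = postCov H ρ z n w w' -
      postCov H ρ z n w (z n) * postCov H ρ z n (z n) w' /
        (1 + postCov H ρ z n (z n) (z n)) := by
  rw [postCov, covSeq_succ_inverse_apply hρ, inner_sub_right, inner_smul_right]
  change postCov H ρ z n w w' - postCov H ρ z n (z n) w' / _ * postCov H ρ z n w (z n) = _
  ring

omit hρ in
lemma gram_apply {Z : Type*} (K : Z → Z → ℝ) {n : ℕ} (z : Fin n → Z) (i j : Fin n) :
    gram K z i j = K (z i) (z j) := rfl

/-- The posterior variance is `ρ ⟪K(w, ·), V⁻¹ K(w, ·)⟫`. -/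
lemma posterior_variance_eq {K : Z → Z → ℝ} (hK : IsRKHSOf H K) {n : ℕ} (z : Fin n → Z) (w : Z)
    (hdet : IsUnit (gram K z + ρ • (1 : Matrix (Fin n) (Fin n) ℝ)).det) :
    K w w - (fun i => K (z i) w) ⬝ᵥ
      Matrix.mulVec (gram K z + ρ • (1 : Matrix (Fin n) (Fin n) ℝ))⁻¹ (fun i => K (z i) w) =
      ρ * ⟪feature H w, (covOp H ρ z).inverse (feature H w)⟫ := by
  set A := gram K z + ρ • (1 : Matrix (Fin n) (Fin n) ℝ) with hA
  set c := Matrix.mulVec A⁻¹ (fun i => K (z i) w) with hc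
  have hAc : A.mulVec c = fun i => K (z i) w := by
    rw [hc, Matrix.mulVec_mulVec, Matrix.mul_nonsing_inv _ hdet, Matrix.one_mulVec]
  -- The residual of kernel ridge regression: its value at `z i` is `ρ * c i`, so `V u = ρ K(w, ·)`,
  -- and pairing with `K(w, ·)` gives the variance.
  set u : H := feature H w - ∑ j, c j • feature H (z j) with hu
  have hui (i : Fin n) : u (z i) = ρ * c i := by
    have h1 := congrFun hAc i
    rw [hA, Matrix.add_mulVec, Matrix.smul_mulVec, Matrix.one_mulVec] at h1
    simp only [Pi.add_apply, Pi.smul_apply, smul_eq_mul, Matrix.mulVec, dotProduct,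
      gram_apply] at h1
    rw [← inner_feature_left, hu, inner_sub_right, inner_sum, hK.inner_feature]
    simp only [inner_smul_right, hK.inner_feature]
    rw [← h1, Finset.sum_congr rfl fun j _ => mul_comm (c j) _]
    ring
  have hV : covOp H ρ z u = ρ • feature H w := by
    rw [covOp_apply]
    simp only [hui, mul_smul, ← Finset.smul_sum]
    rw [← smul_add, hu, add_sub_cancel]
  have hW : u = ρ • (covOp H ρ z).inverse (feature H w) := by
    rw [← map_smul, ← hV, inverse_covOp_apply hρ]
  rw [← inner_smul_right, ← hW, hu, inner_sub_right, inner_sum, hK.inner_feature, dotProduct]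
  congr 1
  refine Finset.sum_congr rfl fun i _ => ?_
  rw [inner_smul_right, hK.inner_feature, hK.symm, mul_comm]

/-- The Schur complement of the old block is `ρ` plus the posterior variance at the new point. -/
lemma det_gram_succ {K : Z → Z → ℝ} (hK : IsRKHSOf H K) (z : ℕ → Z) (n : ℕ)
    (hdet : IsUnit (gram K (fun i : Fin n => z i) + ρ • (1 : Matrix (Fin n) (Fin n) ℝ)).det) :
    (gram K (fun i : Fin (n + 1) => z i) +
        ρ • (1 : Matrix (Fin (n + 1)) (Fin (n + 1)) ℝ)).det =
      (gram K (fun i : Fin n => z i) + ρ • (1 : Matrix (Fin n) (Fin n) ℝ)).det *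
        (ρ * (1 + postCov H ρ z n (z n) (z n))) := by
  set A := gram K (fun i : Fin n => z i) + ρ • (1 : Matrix (Fin n) (Fin n) ℝ) with hA
  let : Invertible A := A.invertibleOfIsUnitDet hdet
  have hpost := posterior_variance_eq hρ hK (fun i : Fin n => z i) (z n) hdet
  rw [← Matrix.det_submatrix_equiv_self (finSumFinEquiv (m := n) (n := 1))]
  have hblock : (gram K (fun i : Fin (n + 1) => z i) +
        ρ • (1 : Matrix (Fin (n + 1)) (Fin (n + 1)) ℝ)).submatrix
        (finSumFinEquiv (m := n) (n := 1)) (finSumFinEquiv (m := n) (n := 1)) =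
      Matrix.fromBlocks A (Matrix.of fun i _ => K (z i) (z n)) (Matrix.of fun _ j => K (z n) (z j))
        (Matrix.of fun _ _ => K (z n) (z n) + ρ) := by
    ext i j
    rcases i with i | i <;> rcases j with j | j
    · simp [hA, gram, Matrix.one_apply]
    · have : Fin.castAdd 1 i ≠ Fin.natAdd n j := Fin.ne_of_val_ne (by simp; omega)
      have hj : j = 0 := Subsingleton.elim _ _
      subst hj
      simp [gram, this]
    · have : Fin.natAdd n i ≠ Fin.castAdd 1 j := Fin.ne_of_val_ne (by simp; omega)
      have hj : i = 0 := Subsingleton.elim _ _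
      subst hj
      simp [gram, this]
    · have hj : j = 0 := Subsingleton.elim _ _
      have hi : i = 0 := Subsingleton.elim _ _
      subst hj hi
      simp [gram]
  rw [hblock, Matrix.det_fromBlocks₁₁, Matrix.det_unique (n := Fin 1)]
  congr 1
  change K (z n) (z n) + ρ - _ = _
  rw [mul_one_add]
  change _ = ρ + ρ * ⟪feature H (z n),
    (covOp H ρ fun i : Fin n => z i).inverse (feature H (z n))⟫
  rw [← hpost, Matrix.invOf_eq_nonsing_inv, Matrix.mul_assoc]
  have : ((Matrix.of fun (_ : Fin 1) (j : Fin n) => K (z n) (z j)) *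
      (A⁻¹ * Matrix.of fun (i : Fin n) (_ : Fin 1) => K (z i) (z n))) default default =
      (fun i : Fin n => K (z i) (z n)) ⬝ᵥ A⁻¹.mulVec fun i : Fin n => K (z i) (z n) := by
    simp only [Matrix.mul_apply, Matrix.of_apply, dotProduct, Matrix.mulVec]
    exact Finset.sum_congr rfl fun i _ => by rw [hK.symm]
  rw [this]
  ring

lemma det_gram_add_smul {K : Z → Z → ℝ} (hK : IsRKHSOf H K) (z : ℕ → Z) (n : ℕ) :
    (gram K (fun i : Fin n => z i) + ρ • (1 : Matrix (Fin n) (Fin n) ℝ)).det =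
      ∏ i ∈ Finset.range n, (ρ * (1 + postCov H ρ z i (z i) (z i))) := by
  induction n with
  | zero => simp
  | succ n ih =>
    rw [det_gram_succ hρ hK z n, Finset.prod_range_succ, ih]
    rw [ih, isUnit_iff_ne_zero, Finset.prod_ne_zero_iff]
    intro i _
    have := postCov_self_nonneg (H := H) hρ z i (z i)
    positivity

lemma isUnit_det_gram {K : Z → Z → ℝ} (hK : IsRKHSOf H K) (z : ℕ → Z) (n : ℕ) :
    IsUnit (gram K (fun i : Fin n => z i) + ρ • (1 : Matrix (Fin n) (Fin n) ℝ)).det := by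
  rw [det_gram_add_smul hρ hK, isUnit_iff_ne_zero, Finset.prod_ne_zero_iff]
  intro i _
  have := postCov_self_nonneg (H := H) hρ z i (z i)
  positivity

lemma sq_posteriorStd {K : Z → Z → ℝ} (hK : IsRKHSOf H K) (z : ℕ → Z) (n : ℕ) (w : Z) :
    posteriorStd K ρ (fun i : Fin n => z i) w ^ 2 = ρ * postCov H ρ z n w w := by
  have h := posterior_variance_eq hρ hK (fun i : Fin n => z i) w (isUnit_det_gram hρ hK z n)
  rw [posteriorStd, h, Real.sq_sqrt]
  · rfl
  · exact mul_nonneg hρ.le (inner_inverse_nonneg hρ _ _)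

omit hρ in
lemma posteriorStd_nonneg {Z : Type*} (K : Z → Z → ℝ) (ρ : ℝ) {n : ℕ} (z : Fin n → Z) (w : Z) :
    0 ≤ posteriorStd K ρ z w := Real.sqrt_nonneg _

lemma posteriorStd_eq {K : Z → Z → ℝ} (hK : IsRKHSOf H K) (z : ℕ → Z) (n : ℕ) (w : Z) :
    posteriorStd K ρ (fun i : Fin n => z i) w =
      √ρ * invCovNorm ρ (fun i : Fin n => z i) (feature H w) := by
  rw [← sq_eq_sq₀ (posteriorStd_nonneg _ _ _ _)
    (mul_nonneg (Real.sqrt_nonneg _) (invCovNorm_nonneg _ _)), sq_posteriorStd hρ hK, mul_pow,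
    Real.sq_sqrt hρ.le, sq_invCovNorm hρ]
  rfl

/-- The chain rule for information gain; it links the determinant to both the mixture martingale and
the sum of widths. -/
lemma log_det_eq {K : Z → Z → ℝ} (hK : IsRKHSOf H K) (z : ℕ → Z) (n : ℕ) :
    Real.log (Matrix.det ((1 : Matrix (Fin n) (Fin n) ℝ) + ρ⁻¹ • gram K (fun i : Fin n => z i))) =
      ∑ i ∈ Finset.range n, Real.log (1 + postCov H ρ z i (z i) (z i)) := by
  have h : (1 : Matrix (Fin n) (Fin n) ℝ) + ρ⁻¹ • gram K (fun i : Fin n => z i) =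
      ρ⁻¹ • (gram K (fun i : Fin n => z i) + ρ • (1 : Matrix (Fin n) (Fin n) ℝ)) := by
    rw [smul_add, inv_smul_smul₀ hρ.ne', add_comm]
  rw [h, Matrix.det_smul, det_gram_add_smul hρ hK, Finset.prod_mul_distrib, Finset.prod_const,
    Finset.card_range, Fintype.card_fin, ← mul_assoc, ← mul_pow, inv_mul_cancel₀ hρ.ne', one_pow,
    one_mul, Real.log_prod]
  intro i _
  have := postCov_self_nonneg (H := H) hρ z i (z i)
  positivity

end Posterior

/-! ### Finiteness, monotonicity and growth of the information gain -/

section InfoGain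

variable {Z : Type*} {H : Type*} [NormedAddCommGroup H] [InnerProductSpace ℝ H] [CompleteSpace H]
  [RKHS ℝ H Z ℝ] {K : Z → Z → ℝ} {ρ C : ℝ}

omit [NormedAddCommGroup H] [InnerProductSpace ℝ H] [CompleteSpace H] [RKHS ℝ H Z ℝ] in
lemma exists_seq_extension [Nonempty Z] {n : ℕ} (z : Fin n → Z) :
    ∃ z' : ℕ → Z, z = fun i : Fin n => z' i :=
  ⟨fun i => if h : i < n then z ⟨i, h⟩ else Classical.arbitrary Z, by ext i; simp⟩

variable [Nonempty Z] (hρ : 0 < ρ) (hK : IsRKHSOf H K) (hC : ∀ w, K w w ≤ C)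
include hρ hK hC

/-- Without boundedness the real supremum in `infoGain` would be the default `0` and dominate
nothing. -/
lemma bddAbove_log_det (n : ℕ) : BddAbove (Set.range fun z : Fin n → Z =>
    (1 / 2) * Real.log (Matrix.det ((1 : Matrix (Fin n) (Fin n) ℝ) + ρ⁻¹ • gram K z))) := by
  refine ⟨1 / 2 * (n * Real.log (1 + C / ρ)), ?_⟩
  rintro _ ⟨z, rfl⟩
  obtain ⟨z, rfl⟩ := exists_seq_extension z
  simp only
  rw [log_det_eq hρ hK]
  refine mul_le_mul_of_nonneg_left ?_ (by norm_num)
  refine (Finset.sum_le_card_nsmul _ _ (Real.log (1 + C / ρ)) fun i _ => ?_).trans_eq (by simp)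
  have h1 := postCov_self_nonneg (H := H) hρ z i (z i)
  have h2 := postCov_self_le hρ hK z i (z i)
  have h3 : K (z i) (z i) / ρ ≤ C / ρ := by gcongr; exact hC _
  exact Real.log_le_log (by linarith) (by linarith)

lemma sum_log_le_infoGain (z : ℕ → Z) (n : ℕ) :
    1 / 2 * ∑ i ∈ Finset.range n, Real.log (1 + postCov H ρ z i (z i) (z i)) ≤
      infoGain K ρ n := by
  rw [← log_det_eq hρ hK]
  exact le_ciSup (bddAbove_log_det hρ hK hC n) fun i : Fin n => z i

lemma infoGain_mono : Monotone (infoGain K ρ) := by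
  refine monotone_nat_of_le_succ fun n => ciSup_le fun z => ?_
  obtain ⟨z, rfl⟩ := exists_seq_extension z
  rw [log_det_eq hρ hK]
  refine le_trans ?_ (sum_log_le_infoGain hρ hK hC z (n + 1))
  rw [Finset.sum_range_succ]
  have := postCov_self_nonneg (H := H) hρ z n (z n)
  have := Real.log_nonneg (show 1 ≤ 1 + postCov H ρ z n (z n) (z n) by linarith)
  linarith

/-- Conditioning only shrinks the variance, so each point gains at most what it would gain alone. It
serves the degenerate case `γ_1 = 0` of `beta_isBigO`. -/
lemma infoGain_le_mul (n : ℕ) : infoGain K ρ n ≤ n * infoGain K ρ 1 := by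
  refine ciSup_le fun z => ?_
  obtain ⟨z, rfl⟩ := exists_seq_extension z
  rw [log_det_eq hρ hK, Finset.mul_sum]
  refine (Finset.sum_le_card_nsmul _ _ (infoGain K ρ 1) fun i _ => ?_).trans_eq (by simp)
  have h := sum_log_le_infoGain hρ hK hC (fun _ => z i) 1
  rw [Finset.sum_range_one, postCov_zero hρ hK] at h
  refine le_trans (mul_le_mul_of_nonneg_left ?_ (by norm_num)) h
  have h1 := postCov_self_nonneg (H := H) hρ z i (z i)
  have h2 := postCov_self_le hρ hK z i (z i)
  exact Real.log_le_log (by linarith) (by linarith)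

lemma infoGain_nonneg (n : ℕ) : 0 ≤ infoGain K ρ n := by
  have h0 := sum_log_le_infoGain hρ hK hC (fun _ => Classical.arbitrary Z) 0
  simp only [Finset.range_zero, Finset.sum_empty, mul_zero] at h0
  exact h0.trans (infoGain_mono hρ hK hC (Nat.zero_le n))

end InfoGain

/-! ### Deterministic error bound for the projected logistic estimate -/

section Estimator

variable {Z : Type*} {H : Type*} [NormedAddCommGroup H] [InnerProductSpace ℝ H] [CompleteSpace H]
  [RKHS ℝ H Z ℝ]

lemma hasDerivAt_logistic (y a : ℝ) :
    HasDerivAt (fun a => -y * Real.log (Real.sigmoid a) -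
      (1 - y) * Real.log (1 - Real.sigmoid a)) (Real.sigmoid a - y) a := by
  have h0 := (Real.sigmoid_pos a).ne'
  have h1 := (sub_pos.2 (Real.sigmoid_lt_one a)).ne'
  have hs := Real.hasDerivAt_sigmoid a
  refine (((hs.log h0).const_mul (-y)).sub
    (((hs.const_sub 1).log h1).const_mul (1 - y))).congr_deriv ?_
  field_simp
  ring

/-- The first-order condition for the minimizer of the regularized logistic loss. -/
lemma gradMap_eq_of_isMin {lam : ℝ} {n : ℕ} {z : Fin n → Z} {y : Fin n → ℝ} {h₀ : H}
    (hmin : ∀ h : H, logisticLoss lam z y h₀ ≤ logisticLoss lam z y h) :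
    gradMap lam z h₀ = ∑ i, y i • feature H (z i) := by
  rw [← sub_eq_zero]
  refine ext_inner_right ℝ fun u => ?_
  rw [inner_zero_left]
  have hd : HasDerivAt (fun t : ℝ => logisticLoss lam z y (h₀ + t • u))
      ((∑ i, (Real.sigmoid (h₀ (z i)) - y i) * u (z i)) + lam * ⟪h₀, u⟫) 0 := by
    have hlin (i : Fin n) : HasDerivAt (fun t : ℝ => (h₀ + t • u) (z i)) (u (z i)) 0 := by
      have : (fun t : ℝ => (h₀ + t • u) (z i)) = fun t : ℝ => h₀ (z i) + t * u (z i) := by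
        ext t; simp
      rw [this]
      simpa using ((hasDerivAt_id (0 : ℝ)).mul_const (u (z i))).const_add (h₀ (z i))
    have hsum := HasDerivAt.fun_sum (u := Finset.univ) fun i (_ : i ∈ Finset.univ) =>
      (hasDerivAt_logistic (y i) ((h₀ + (0 : ℝ) • u) (z i))).comp (0 : ℝ) (hlin i)
    have hnorm : HasDerivAt (fun t : ℝ => lam / 2 * ‖h₀ + t • u‖ ^ 2) (lam * ⟪h₀, u⟫) 0 := by
      have h2 : HasDerivAt (fun t : ℝ => h₀ + t • u) u 0 := by
        simpa using ((hasDerivAt_id (0 : ℝ)).smul_const u).const_add h₀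
      refine (h2.norm_sq.const_mul (lam / 2)).congr_deriv ?_
      rw [zero_smul, add_zero]
      ring
    simp only [zero_smul, add_zero] at hsum
    exact hsum.add hnorm
  have h0 : IsLocalMin (fun t : ℝ => logisticLoss lam z y (h₀ + t • u)) 0 := by
    refine Filter.Eventually.of_forall fun t => ?_
    simpa using hmin (h₀ + t • u)
  have := h0.hasDerivAt_eq_zero hd
  rw [← this, gradMap, inner_sub_left, inner_add_left, sum_inner, sum_inner, inner_smul_left]
  simp only [inner_smul_left, inner_feature_left, RCLike.conj_to_real, sub_mul,
    Finset.sum_sub_distrib]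
  ring

variable {lam B R : ℝ} (hlam : 0 < lam) (hR : 0 ≤ R)
include hlam hR

/-- The gradient map is strongly monotone, so it controls point evaluations on the ball. -/
lemma abs_apply_sub_le {n : ℕ} (z : Fin n → Z) {h₁ h₂ : H}
    (hb₁ : ∀ w, |h₁ w| ≤ R) (hb₂ : ∀ w, |h₂ w| ≤ R) (w : Z) :
    |h₁ w - h₂ w| ≤ invCovNorm (lam * kappa R) z (feature H w) *
      (kappa R * invCovNorm (lam * kappa R) z (gradMap lam z h₁ - gradMap lam z h₂)) := by
  have hκ : 0 < kappa R := by linarith [four_le_kappa hR]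
  have hρ : 0 < lam * kappa R := mul_pos hlam hκ
  set ρ := lam * kappa R with hρdef
  set G := gradMap lam z h₁ - gradMap lam z h₂ with hG
  set d := h₁ - h₂ with hd
  set N := invCovNorm ρ z (covOp H ρ z d) with hN
  have hN2 : N ^ 2 = ⟪d, covOp H ρ z d⟫ := by
    rw [hN, sq_invCovNorm hρ, inverse_covOp_apply hρ, covOp_symm]
  have hdG : ⟪d, G⟫ = (∑ i, (Real.sigmoid (h₁ (z i)) - Real.sigmoid (h₂ (z i))) *
      (h₁ (z i) - h₂ (z i))) + lam * ‖d‖ ^ 2 := by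
    have : G = (∑ i, (Real.sigmoid (h₁ (z i)) - Real.sigmoid (h₂ (z i))) • feature H (z i)) +
        lam • d := by
      rw [hG, hd, gradMap, gradMap, smul_sub]
      simp only [sub_smul, Finset.sum_sub_distrib]
      abel
    rw [this, inner_add_right, inner_sum, inner_smul_right, real_inner_self_eq_norm_sq]
    simp only [inner_smul_right, inner_feature_right, hd, RKHS.coe_sub, Pi.sub_apply]
  -- The slope of `s` on the range is at least `1 / κ`; the ridge `lam * kappa R` is exactly what
  -- makes the regularization terms match.
  have h1 : N ^ 2 ≤ kappa R * ⟪d, G⟫ := by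
    rw [hN2, inner_covOp, hdG, mul_add, Finset.mul_sum, real_inner_self_eq_norm_sq]
    refine add_le_add (Finset.sum_le_sum fun i _ => ?_) (le_of_eq (by rw [hρdef]; ring))
    have := sq_sub_le_kappa_mul (hb₁ (z i)) (hb₂ (z i))
    simpa [hd, sq] using this
  have h2 : ⟪d, G⟫ ≤ N * invCovNorm ρ z G := by
    have h := abs_inner_inverse_le hρ z (covOp H ρ z d) G
    rw [covOp_symm, covOp_inverse_apply hρ] at h
    exact (le_abs_self _).trans h
  have hNnn : 0 ≤ N := invCovNorm_nonneg _ _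
  have h3 : N ≤ kappa R * invCovNorm ρ z G := by
    rcases hNnn.eq_or_lt with h0 | h0
    · rw [← h0]; exact mul_nonneg hκ.le (invCovNorm_nonneg _ _)
    · have := h1.trans (mul_le_mul_of_nonneg_left h2 hκ.le)
      exact le_of_mul_le_mul_left (by nlinarith) h0
  have h4 := abs_inner_inverse_le hρ z (feature H w) (covOp H ρ z d)
  rw [inverse_covOp_apply hρ, inner_feature_left, hd, RKHS.coe_sub, Pi.sub_apply] at h4
  exact h4.trans (mul_le_mul_of_nonneg_left h3 (invCovNorm_nonneg _ _))

/-- The confidence bound for the projected estimate, on the event that the self-normalized noise is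
bounded by `Q`. -/
lemma IsEstimate.abs_sigmoid_sub_le {n : ℕ} {z : Fin n → Z} {y : Fin n → ℝ} {h hs : H}
    (hest : IsEstimate lam B R z y h) (hbd : ∀ h : H, ‖h‖ ≤ B → ∀ w, |h w| ≤ R) (hsB : ‖hs‖ ≤ B)
    {Q : ℝ} (hQ : invCovNorm (lam * kappa R) z
      (∑ i, (y i - Real.sigmoid (hs (z i))) • feature H (z i)) ≤ Q) (w : Z) :
    |Real.sigmoid (h w) - Real.sigmoid (hs w)| ≤ lipConst R *
      (invCovNorm (lam * kappa R) z (feature H w) *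
        (kappa R * (2 * (Q + lam * B / √(lam * kappa R))))) := by
  obtain ⟨h₀, hmin, hhB, hproj⟩ := hest
  have hκ : 0 < kappa R := by linarith [four_le_kappa hR]
  have hρ : 0 < lam * kappa R := mul_pos hlam hκ
  set ρ := lam * kappa R with hρdef
  have hg : invCovNorm ρ z (gradMap lam z hs - gradMap lam z h₀) ≤ Q + lam * B / √ρ := by
    have : gradMap lam z hs - gradMap lam z h₀ =
        lam • hs - ∑ i, (y i - Real.sigmoid (hs (z i))) • feature H (z i) := by
      rw [gradMap_eq_of_isMin hmin, gradMap]
      simp only [sub_smul, Finset.sum_sub_distrib]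
      abel
    rw [this, add_comm]
    refine (invCovNorm_sub_le hρ z _ _).trans (add_le_add ((invCovNorm_le hρ z _).trans ?_) hQ)
    rw [norm_smul, Real.norm_eq_abs, abs_of_pos hlam]
    gcongr
  -- The true function competes in the projection, so `h` is at least as close to `h₀` as `hs` is;
  -- the triangle inequality costs the factor `2`.
  have hgg : invCovNorm ρ z (gradMap lam z h - gradMap lam z hs) ≤
      2 * (Q + lam * B / √ρ) := by
    have : gradMap lam z h - gradMap lam z hs =
        (gradMap lam z h - gradMap lam z h₀) - (gradMap lam z hs - gradMap lam z h₀) := by abel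
    rw [this]
    have h1 := invCovNorm_sub_le hρ z (gradMap lam z h - gradMap lam z h₀)
      (gradMap lam z hs - gradMap lam z h₀)
    linarith [hproj hs hsB]
  refine (DuelingBandit.abs_sigmoid_sub_le (hbd h hhB w) (hbd hs hsB w)).trans
    (mul_le_mul_of_nonneg_left ?_ (lipConst_nonneg R))
  refine (abs_apply_sub_le hlam hR z (hbd h hhB) (hbd hs hsB) w).trans ?_
  exact mul_le_mul_of_nonneg_left (mul_le_mul_of_nonneg_left hgg hκ.le) (invCovNorm_nonneg _ _)

lemma IsEstimate.abs_sigmoid_sub_le_beta {K : Z → Z → ℝ} (hK : IsRKHSOf H K) {n : ℕ} {z : ℕ → Z}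
    {y : Fin n → ℝ} {h hs : H} {δ : ℝ}
    (hest : IsEstimate lam B R (fun i : Fin n => z i) y h)
    (hbd : ∀ h : H, ‖h‖ ≤ B → ∀ w, |h w| ≤ R) (hsB : ‖hs‖ ≤ B)
    (hQ : invCovNorm (lam * kappa R) (fun i : Fin n => z i)
      (∑ i : Fin n, (y i - Real.sigmoid (hs (z i))) • feature H (z i)) ≤
        √(2 * (infoGain K (lam * kappa R) n + Real.log (1 / δ)))) (w : Z) :
    |Real.sigmoid (h w) - Real.sigmoid (hs w)| ≤ beta K lam B R δ n *
      posteriorStd K (lam * kappa R) (fun i : Fin n => z i) w := by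
  have hκ : 0 < kappa R := by linarith [four_le_kappa hR]
  have hρ : 0 < lam * kappa R := mul_pos hlam hκ
  have hB : 0 ≤ B := (norm_nonneg _).trans hsB
  have hL := lipConst_nonneg R
  refine (hest.abs_sigmoid_sub_le hlam hR hbd hsB hQ w).trans ?_
  rw [posteriorStd_eq hρ hK, beta]
  set ν := invCovNorm (lam * kappa R) (fun i : Fin n => z i) (feature H w) with hν
  have hν0 : 0 ≤ ν := invCovNorm_nonneg _ _
  set γ := infoGain K (lam * kappa R) n + Real.log (1 / δ)
  set r := √(lam * kappa R) with hr
  have hr0 : 0 < r := Real.sqrt_pos.2 hρ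
  have hr2 : r * r = lam * kappa R := Real.mul_self_sqrt hρ.le
  have hs : kappa R * √(2 * γ) = √(2 * kappa R / lam * γ) * r := by
    rw [hr, ← Real.sqrt_mul' _ hρ.le,
      show 2 * kappa R / lam * γ * (lam * kappa R) = kappa R ^ 2 * (2 * γ) by field_simp,
      Real.sqrt_mul (sq_nonneg _), Real.sqrt_sq hκ.le]
  have hB2 : kappa R * (lam * B / r) = B * r := by
    rw [← mul_div_assoc, div_eq_iff hr0.ne', mul_assoc, hr2]; ring
  have : lipConst R * (ν * (kappa R * (2 * (√(2 * γ) + lam * B / r)))) =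
      lipConst R * ν * 2 * (kappa R * √(2 * γ) + kappa R * (lam * B / r)) := by ring
  rw [this, hs, hB2]
  -- The bias contributes only `2 L B σ`; the `4 L B` in `beta` leaves this slack.
  have : 0 ≤ lipConst R * ν * B * r := by positivity
  nlinarith

end Estimator

/-! ### Utility differences in the dueling RKHS, and measurability -/

section Differences

variable {X : Type*} {H : Type*} [NormedAddCommGroup H] [InnerProductSpace ℝ H] [CompleteSpace H]
  [RKHS ℝ H X ℝ] {HD : Type*} [NormedAddCommGroup HD] [InnerProductSpace ℝ HD] [CompleteSpace HD]
  [RKHS ℝ HD (X × X) ℝ] {k : X → X → ℝ}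

lemma closure_span_feature (X : Type*) (H : Type*) [NormedAddCommGroup H] [InnerProductSpace ℝ H]
    [CompleteSpace H] [RKHS ℝ H X ℝ] :
    (Submodule.span ℝ (Set.range (feature H : X → H))).topologicalClosure = ⊤ := by
  refine eq_top_iff.2 (le_trans (RKHS.kerFun_dense H).ge (Submodule.topologicalClosure_mono ?_))
  rw [Submodule.span_le]
  rintro _ ⟨x, v, rfl⟩
  have : RKHS.kerFun H x v = v • feature H x := by
    rw [feature, ← map_smul, smul_eq_mul, mul_one]
  rw [this]
  exact Submodule.smul_mem _ _ (Submodule.subset_span ⟨x, rfl⟩)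

/-- Utility differences belong to the RKHS of the dueling kernel, with no larger norm. -/
lemma exists_dueling_difference (hH : IsRKHSOf H k) (hHD : IsRKHSOf HD (duelingKernel k)) (f : H) :
    ∃ h : HD, ‖h‖ ≤ ‖f‖ ∧ ∀ x x' : X, h (x, x') = f x - f x' := by
  -- The dueling kernel is the Gram kernel of `K(x, ·) - K(x', ·)`, so `e c` and `g c` have equal
  -- norms. The functional `⟪f, g c⟫` is thus bounded by `‖f‖ ‖e c‖`, extends along the dense range
  -- of `e`, and is represented by Riesz.
  let e : (X × X →₀ ℝ) →ₗ[ℝ] HD := Finsupp.linearCombination ℝ (feature HD)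
  let g : (X × X →₀ ℝ) →ₗ[ℝ] H :=
    Finsupp.linearCombination ℝ fun z : X × X => feature H z.1 - feature H z.2
  have hinner (z w : X × X) : ⟪feature H z.1 - feature H z.2, feature H w.1 - feature H w.2⟫ =
      ⟪feature HD z, feature HD w⟫ := by
    rw [hHD.inner_feature, inner_sub_left, inner_sub_right, inner_sub_right]
    simp only [hH.inner_feature, duelingKernel]
    ring
  have hnorm (c : X × X →₀ ℝ) : ‖g c‖ = ‖e c‖ := by
    rw [← sq_eq_sq₀ (norm_nonneg _) (norm_nonneg _), ← real_inner_self_eq_norm_sq,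
      ← real_inner_self_eq_norm_sq]
    simp only [g, e, Finsupp.linearCombination_apply, Finsupp.sum, inner_sum, sum_inner,
      inner_smul_left, inner_smul_right, hinner]
  have hdense : DenseRange e := by
    have h1 := closure_span_feature (X × X) HD
    rw [← Finsupp.range_linearCombination, ← Submodule.dense_iff_topologicalClosure_eq_top] at h1
    exact h1
  let ℓ : (X × X →₀ ℝ) →ₗ[ℝ] ℝ := (innerₗ H f).comp g
  have hℓ (c : X × X →₀ ℝ) : ‖ℓ c‖ ≤ ‖f‖ * ‖e c‖ := by
    rw [← hnorm]
    exact norm_inner_le_norm f (g c)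
  refine ⟨(InnerProductSpace.toDual ℝ HD).symm (ℓ.extendOfNorm e), ?_, fun x x' => ?_⟩
  · rw [LinearIsometryEquiv.norm_map]
    exact LinearMap.opNorm_extendOfNorm_le hdense (norm_nonneg f) hℓ
  · rw [← inner_feature_right, InnerProductSpace.toDual_symm_apply]
    have he : feature HD (x, x') = e (Finsupp.single (x, x') 1) := by simp [e]
    rw [he, LinearMap.extendOfNorm_eq hdense ⟨_, hℓ⟩]
    simp [ℓ, g, inner_sub_right, inner_feature_right, -RKHS.inner_kerFun]

/-- The functions of the RKHS of a measurable kernel are measurable. -/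
lemma IsRKHSOf.measurable_coe [MeasurableSpace X] (hH : IsRKHSOf H k)
    (hk : Measurable (Function.uncurry k)) (f : H) : Measurable fun x => f x := by
  have hf : f ∈ (Submodule.span ℝ (Set.range (feature H : X → H))).topologicalClosure := by
    rw [closure_span_feature]; trivial
  -- Norm limits are pointwise limits, and finite combinations of kernel sections are measurable.
  obtain ⟨u, hu, hlim⟩ := mem_closure_iff_seq_limit.1 hf
  refine measurable_of_tendsto_metrizable (f := fun n x => u n x) (fun n => ?_)
    (tendsto_pi_nhds.2 fun x => ((RKHS.continuous_eval x).tendsto f).comp hlim)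
  refine Submodule.span_induction (p := fun g _ => Measurable fun x => g x) ?_ ?_ ?_ ?_ (hu n)
  · rintro _ ⟨w, rfl⟩
    have : (fun x => feature H w x) = fun x => k x w := by
      ext x; rw [RKHS.kerFun_apply, hH]
    rw [this]
    exact hk.comp (measurable_id.prodMk measurable_const)
  · simp only [RKHS.coe_zero]; exact measurable_const
  · intro g₁ g₂ _ _ h₁ h₂
    simp only [RKHS.coe_add]; exact h₁.add h₂
  · intro c g _ h
    simp only [RKHS.coe_smul]; exact h.const_smul c

end Differences

/-! ### One-dimensional Gaussian mixtures for Bernoulli noise -/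

section Mixture

lemma exp_quadratic_eq {a : ℝ} (ha : 0 < a) (b c x : ℝ) :
    Real.exp (-a * x ^ 2 + b * x + c) =
      Real.exp (b ^ 2 / (4 * a) + c) * Real.exp (-a * (x - b / (2 * a)) ^ 2) := by
  rw [← Real.exp_add]
  congr 1
  field_simp
  ring

lemma integrable_exp_quadratic {a : ℝ} (ha : 0 < a) (b c : ℝ) :
    Integrable fun x : ℝ => Real.exp (-a * x ^ 2 + b * x + c) := by
  simp_rw [exp_quadratic_eq ha]
  exact ((integrable_exp_neg_mul_sq ha).comp_sub_right (b / (2 * a))).const_mul _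

lemma integral_exp_quadratic {a : ℝ} (ha : 0 < a) (b c : ℝ) :
    ∫ x : ℝ, Real.exp (-a * x ^ 2 + b * x + c) =
      Real.exp (b ^ 2 / (4 * a) + c) * √(Real.pi / a) := by
  simp_rw [exp_quadratic_eq ha]
  rw [integral_const_mul,
    integral_sub_right_eq_self (fun x : ℝ => Real.exp (-a * x ^ 2)) (b / (2 * a)),
    integral_gaussian]

/-- Hoeffding's lemma for a centered Bernoulli variable. -/
lemma bernoulli_mgf_le {p : ℝ} (hp0 : 0 ≤ p) (hp1 : p ≤ 1) (t : ℝ) :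
    p * Real.exp ((1 - p) * t) + (1 - p) * Real.exp (-p * t) ≤ Real.exp (t ^ 2 / 2) := by
  let ν : Measure ℝ := ENNReal.ofReal p • Measure.dirac 1 + ENNReal.ofReal (1 - p) • Measure.dirac 0
  have hprob : IsProbabilityMeasure ν := by
    refine ⟨?_⟩
    simp only [ν, Measure.add_apply, Measure.smul_apply, measure_univ, smul_eq_mul, mul_one]
    rw [← ENNReal.ofReal_add hp0 (by linarith)]
    simp
  have hint (g : ℝ → ℝ) : ∫ x, g x ∂ν = p * g 1 + (1 - p) * g 0 := by
    rw [integral_add_measure, integral_smul_measure, integral_smul_measure, integral_dirac,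
      integral_dirac, ENNReal.toReal_ofReal hp0, ENNReal.toReal_ofReal (by linarith), smul_eq_mul,
      smul_eq_mul]
    · exact (integrable_dirac (by simp)).smul_measure (by simp)
    · exact (integrable_dirac (by simp)).smul_measure (by simp)
  have hmem : ∀ᵐ x ∂ν, id x ∈ Set.Icc (0 : ℝ) 1 := by
    rw [ae_iff]
    simp [ν]
  -- Hoeffding on `[0, 1]` gives exponent `t² / 8`; the weaker `t² / 2` suffices to cancel against
  -- the exponent of the mixture.
  have h := (hasSubgaussianMGF_of_mem_Icc (μ := ν) (X := id) aemeasurable_id hmem).mgf_le t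
  rw [mgf, hint, hint] at h
  simp only [id, mul_one, mul_zero, add_zero] at h
  refine le_trans (le_of_eq ?_) (h.trans (Real.exp_le_exp.2 ?_))
  · ring_nf
  · simp
    nlinarith [sq_nonneg t]

/-- The factor by which the Gaussian mixture of exponential martingales changes when the noise `ε`
is observed at a point with posterior mean `μ` and variance `v`. -/
def mixtureFactor (v μ ε : ℝ) : ℝ :=
  Real.exp ((v * ε ^ 2 + 2 * μ * ε - μ ^ 2) / (2 * (1 + v)) - Real.log (1 + v) / 2)

/-- `mixtureFactor v μ ε` is the mean of `exp(ε m - m² / 2)` over `m ~ N(μ, v)`. Writing `m = μ + √v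
x` with `x` standard normal also covers `v = 0`. -/
lemma integral_mixture {v : ℝ} (hv : 0 ≤ v) (μ ε : ℝ) :
    Integrable (fun x : ℝ =>
      Real.exp (ε * (μ + √v * x)) * Real.exp (-(μ + √v * x) ^ 2 / 2 - x ^ 2 / 2)) ∧
    ∫ x : ℝ, Real.exp (ε * (μ + √v * x)) * Real.exp (-(μ + √v * x) ^ 2 / 2 - x ^ 2 / 2) =
      mixtureFactor v μ ε * √(2 * Real.pi) := by
  have ha : 0 < (1 + v) / 2 := by linarith
  have hv1 : 0 < 1 + v := by linarith
  have hs : √v ^ 2 = v := Real.sq_sqrt hv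
  have heq (x : ℝ) :
      Real.exp (ε * (μ + √v * x)) * Real.exp (-(μ + √v * x) ^ 2 / 2 - x ^ 2 / 2) =
      Real.exp (-((1 + v) / 2) * x ^ 2 + (√v * (ε - μ)) * x + (ε * μ - μ ^ 2 / 2)) := by
    rw [← Real.exp_add]
    congr 1
    linear_combination (-(x ^ 2) / 2) * hs
  simp_rw [heq]
  refine ⟨integrable_exp_quadratic ha _ _, ?_⟩
  rw [integral_exp_quadratic ha, mixtureFactor, Real.exp_sub,
    show Real.pi / ((1 + v) / 2) = 2 * Real.pi / (1 + v) by field_simp,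
    Real.sqrt_div' _ hv1.le, ← Real.log_sqrt hv1.le, Real.exp_log (Real.sqrt_pos.2 hv1)]
  have : (√v * (ε - μ)) ^ 2 / (4 * ((1 + v) / 2)) + (ε * μ - μ ^ 2 / 2) =
      (v * ε ^ 2 + 2 * μ * ε - μ ^ 2) / (2 * (1 + v)) := by
    rw [mul_pow, hs]
    field_simp
    ring
  rw [this]
  ring

/-- The one-step supermartingale inequality: Hoeffding's bound holds for each fixed `m` in the
mixture, and integrating it leaves the mass of the standard Gaussian. -/
lemma bernoulli_mixtureFactor_le {p v : ℝ} (hp0 : 0 ≤ p) (hp1 : p ≤ 1) (hv : 0 ≤ v) (μ : ℝ) :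
    p * mixtureFactor v μ (1 - p) + (1 - p) * mixtureFactor v μ (-p) ≤ 1 := by
  obtain ⟨hi1, he1⟩ := integral_mixture hv μ (1 - p)
  obtain ⟨hi2, he2⟩ := integral_mixture hv μ (-p)
  have hpi : 0 < √(2 * Real.pi) := Real.sqrt_pos.2 (by positivity)
  have hgi : Integrable fun x : ℝ => Real.exp (-(1 / 2) * x ^ 2 + 0 * x + 0) :=
    integrable_exp_quadratic (by norm_num) 0 0
  have hge : ∫ x : ℝ, Real.exp (-(1 / 2) * x ^ 2 + 0 * x + 0) = √(2 * Real.pi) := by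
    rw [integral_exp_quadratic (by norm_num)]
    simp [mul_comm]
  refine le_of_mul_le_mul_right ?_ hpi
  rw [add_mul, mul_assoc, mul_assoc, ← he1, ← he2, one_mul, ← hge, ← integral_const_mul,
    ← integral_const_mul, ← integral_add (hi1.const_mul p) (hi2.const_mul (1 - p))]
  refine integral_mono ((hi1.const_mul p).add (hi2.const_mul (1 - p))) hgi fun x => ?_
  have h := bernoulli_mgf_le hp0 hp1 (μ + √v * x)
  have h2 := mul_le_mul_of_nonneg_right h
    (Real.exp_nonneg (-(μ + √v * x) ^ 2 / 2 - x ^ 2 / 2))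
  rw [← Real.exp_add] at h2
  simp only
  refine le_trans (le_of_eq (by ring)) (h2.trans (le_of_eq ?_))
  congr 1
  ring

end Mixture

/-! ### Ville's inequality and the supermartingale property -/

section Maximal

variable {Ω : Type*} {mΩ : MeasurableSpace Ω} {P : Measure Ω}

/-- Pulling out a known factor with no integrability condition on `g`: the measures with densities
`Y` and `p` agree on `m`. -/
lemma lintegral_mul_eq_of_condExp_eq [IsFiniteMeasure P] {m : MeasurableSpace Ω} (hm : m ≤ mΩ)
    {Y p : Ω → ℝ} (hY : Integrable Y P) (hY0 : 0 ≤ Y) (hp : Measurable[mΩ] p) (hp0 : 0 ≤ p)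
    (h : P[Y | m] =ᵐ[P] p) {g : Ω → ENNReal} (hg : Measurable[m] g) :
    ∫⁻ ω, ENNReal.ofReal (Y ω) * g ω ∂P = ∫⁻ ω, ENNReal.ofReal (p ω) * g ω ∂P := by
  have hg' : Measurable[mΩ] g := hg.mono hm le_rfl
  have hpi : Integrable p P := integrable_condExp.congr h
  have htrim : (P.withDensity fun ω => ENNReal.ofReal (Y ω)).trim hm =
      (P.withDensity fun ω => ENNReal.ofReal (p ω)).trim hm := by
    refine @Measure.ext _ m _ _ fun A hA => ?_
    have hA' := hm A hA
    rw [trim_measurableSet_eq hm hA, trim_measurableSet_eq hm hA, withDensity_apply _ hA',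
      withDensity_apply _ hA', ← ofReal_integral_eq_lintegral_ofReal hY.integrableOn
        (Eventually.of_forall hY0), ← ofReal_integral_eq_lintegral_ofReal hpi.integrableOn
        (Eventually.of_forall hp0), ← setIntegral_condExp hm hY hA]
    congr 1
    exact integral_congr_ae (ae_restrict_of_ae h)
  have h1 := lintegral_trim (μ := P.withDensity fun ω => ENNReal.ofReal (Y ω)) hm hg
  have h2 := lintegral_trim (μ := P.withDensity fun ω => ENNReal.ofReal (p ω)) hm hg
  rw [lintegral_withDensity_eq_lintegral_mul₀ hY.1.aemeasurable.ennreal_ofReal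
    hg'.aemeasurable] at h1
  rw [lintegral_withDensity_eq_lintegral_mul₀ hp.ennreal_ofReal.aemeasurable hg'.aemeasurable] at h2
  simp only [Pi.mul_apply] at h1 h2
  rw [← h1, ← h2, htrim]

/-- Ville's maximal inequality. -/
lemma mul_measure_exists_le_lintegral {ℱ : Filtration ℕ mΩ} {N : ℕ → Ω → ENNReal}
    (hN : ∀ n, Measurable[ℱ n] (N n))
    (hsuper : ∀ n A, MeasurableSet[ℱ n] A → ∫⁻ ω in A, N (n + 1) ω ∂P ≤ ∫⁻ ω in A, N n ω ∂P)
    (c : ENNReal) : c * P {ω | ∃ n, c ≤ N n ω} ≤ ∫⁻ ω, N 0 ω ∂P := by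
  let A : ℕ → Set Ω := fun n => {ω | ∀ i ≤ n, N i ω < c}
  have hA (n : ℕ) : MeasurableSet[ℱ n] (A n) := by
    have : A n = ⋂ i ∈ Set.Iic n, {ω | N i ω < c} := by ext; simp [A]
    rw [this]
    refine MeasurableSet.biInter (Set.to_countable _) fun i hi => ?_
    exact ℱ.mono hi _ (hN i measurableSet_Iio)
  have hA' (n : ℕ) : MeasurableSet (A n) := ℱ.le n _ (hA n)
  have hNm (n : ℕ) : Measurable (N n) := (hN n).mono (ℱ.le n) le_rfl
  -- The process stopped on reaching `c`: paths that have crossed are charged `c`, the others their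
  -- current value.
  have key (n : ℕ) : c * P (A n)ᶜ + ∫⁻ ω in A n, N n ω ∂P ≤ ∫⁻ ω, N 0 ω ∂P := by
    induction n with
    | zero =>
      rw [← lintegral_add_compl (μ := P) (N 0) (hA' 0), add_comm]
      refine add_le_add le_rfl ?_
      rw [← setLIntegral_const]
      refine setLIntegral_mono (hNm 0) fun ω hω => ?_
      simpa [A] using hω
    | succ n ih =>
      refine le_trans ?_ ih
      have hsub : A (n + 1) ⊆ A n := fun ω hω i hi => hω i (hi.trans (Nat.le_succ n))
      have hcompl : (A (n + 1))ᶜ = (A n)ᶜ ∪ (A n \ A (n + 1)) := by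
        ext ω
        have := @hsub ω
        simp only [Set.mem_compl_iff, Set.mem_union, Set.mem_sdiff]
        tauto
      have hdisj : Disjoint (A n)ᶜ (A n \ A (n + 1)) :=
        disjoint_compl_left.mono_right Set.sdiff_subset
      rw [hcompl, measure_union hdisj ((hA' n).diff (hA' (n + 1))), mul_add, add_assoc]
      gcongr
      refine le_trans ?_ (hsuper n (A n) (hA n))
      rw [← lintegral_inter_add_sdiff (N (n + 1)) (A n) (hA' (n + 1)),
        Set.inter_eq_right.2 hsub, add_comm]
      gcongr
      rw [← setLIntegral_const]
      refine setLIntegral_mono (hNm (n + 1)) fun ω hω => ?_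
      by_contra hlt
      refine hω.2 fun i hi => ?_
      rcases Nat.le_succ_iff.1 hi with h | h
      · exact hω.1 i h
      · rw [h]; exact not_le.1 hlt
  have hunion : {ω | ∃ n, c ≤ N n ω} = ⋃ n, (A n)ᶜ := by
    ext ω
    simp only [Set.mem_ofPred_eq, Set.mem_iUnion, Set.mem_compl_iff, A, not_forall, not_lt]
    exact ⟨fun ⟨n, h⟩ => ⟨n, n, le_rfl, h⟩, fun ⟨_, n, _, h⟩ => ⟨n, h⟩⟩
  have hmono : Monotone fun n => (A n)ᶜ := fun m n hmn =>
    Set.compl_subset_compl.2 fun ω hω i hi => hω i (hi.trans hmn)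
  rw [hunion, hmono.measure_iUnion, ENNReal.mul_iSup]
  exact iSup_le fun n => le_self_add.trans (key n)

/-- The mixture martingale of binary observations stays below `1 / δ` with probability at least
`1 - δ`. -/
lemma ofReal_le_measure_mixture_lt [IsProbabilityMeasure P] {ℱ : Filtration ℕ mΩ}
    {y p v μ M : ℕ → Ω → ℝ} (hy : ∀ n, Measurable[ℱ (n + 1)] (y n))
    (hbin : ∀ n ω, y n ω = 0 ∨ y n ω = 1)
    (hp : ∀ n, Measurable[ℱ n] (p n)) (hp0 : ∀ n ω, 0 ≤ p n ω) (hp1 : ∀ n ω, p n ω ≤ 1)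
    (hcond : ∀ n, P[y n | ℱ n] =ᵐ[P] p n)
    (hv : ∀ n, Measurable[ℱ n] (v n)) (hv0 : ∀ n ω, 0 ≤ v n ω) (hμ : ∀ n, Measurable[ℱ n] (μ n))
    (hM0 : ∀ ω, M 0 ω = 1)
    (hM : ∀ n ω, M (n + 1) ω = M n ω * mixtureFactor (v n ω) (μ n ω) (y n ω - p n ω))
    {δ : ℝ} (hδ : 0 < δ) :
    ENNReal.ofReal (1 - δ) ≤ P {ω | ∀ n, M n ω < 1 / δ} := by
  have hmf {m : MeasurableSpace Ω} {a b c : Ω → ℝ} (ha : Measurable[m] a) (hb : Measurable[m] b)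
      (hc : Measurable[m] c) : Measurable[m] fun ω => mixtureFactor (a ω) (b ω) (c ω) := by
    unfold mixtureFactor
    fun_prop
  have hMm (n : ℕ) : Measurable[ℱ n] (M n) := by
    induction n with
    | zero => rw [funext hM0]; exact measurable_const
    | succ n ih =>
      have hle := ℱ.mono (Nat.le_succ n)
      rw [funext (hM n)]
      exact Measurable.mul (ih.mono hle le_rfl) (hmf ((hv n).mono hle le_rfl)
        ((hμ n).mono hle le_rfl) (Measurable.sub (hy n) ((hp n).mono hle le_rfl)))
  have hMnn (n : ℕ) (ω : Ω) : 0 ≤ M n ω := by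
    induction n with
    | zero => rw [hM0]; exact zero_le_one
    | succ n ih => rw [hM]; exact mul_nonneg ih (Real.exp_nonneg _)
  have hsuper (n : ℕ) (A : Set Ω) (hA : MeasurableSet[ℱ n] A) :
      ∫⁻ ω in A, ENNReal.ofReal (M (n + 1) ω) ∂P ≤ ∫⁻ ω in A, ENNReal.ofReal (M n ω) ∂P := by
    have hym : Measurable (y n) := (hy n).mono (ℱ.le _) le_rfl
    have hpm : Measurable (p n) := (hp n).mono (ℱ.le _) le_rfl
    have hyi : Integrable (y n) P := by
      refine Integrable.of_mem_Icc 0 1 hym.aemeasurable (Eventually.of_forall fun ω => ?_)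
      rcases hbin n ω with h | h <;> simp [h]
    have hy0 : 0 ≤ y n := fun ω => by rcases hbin n ω with h | h <;> simp [h]
    have hy1 : 0 ≤ fun ω => 1 - y n ω := fun ω => by rcases hbin n ω with h | h <;> simp [h]
    have hcond' : P[fun ω => 1 - y n ω | ℱ n] =ᵐ[P] fun ω => 1 - p n ω := by
      have h1 := condExp_sub (μ := P) (integrable_const (1 : ℝ)) hyi (ℱ n)
      rw [condExp_const (ℱ.le n)] at h1
      filter_upwards [h1, hcond n] with ω h h'
      change P[(fun _ => (1 : ℝ)) - y n | ℱ n] ω = _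
      rw [h, Pi.sub_apply, h']
    let g₁ : Ω → ENNReal := A.indicator fun ω =>
      ENNReal.ofReal (M n ω * mixtureFactor (v n ω) (μ n ω) (1 - p n ω))
    let g₀ : Ω → ENNReal := A.indicator fun ω =>
      ENNReal.ofReal (M n ω * mixtureFactor (v n ω) (μ n ω) (-p n ω))
    have hg₁ : Measurable[ℱ n] g₁ := Measurable.indicator
      (Measurable.ennreal_ofReal (Measurable.mul (hMm n)
        (hmf (hv n) (hμ n) (Measurable.const_sub (hp n) 1)))) hA
    have hg₀ : Measurable[ℱ n] g₀ := Measurable.indicator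
      (Measurable.ennreal_ofReal (Measurable.mul (hMm n)
        (hmf (hv n) (hμ n) (Measurable.neg (hp n))))) hA
    have hA' := ℱ.le n _ hA
    have hg₁' : Measurable g₁ := hg₁.mono (ℱ.le n) le_rfl
    have hg₀' : Measurable g₀ := hg₀.mono (ℱ.le n) le_rfl
    have e₁ := lintegral_mul_eq_of_condExp_eq (ℱ.le n) hyi hy0 hpm (hp0 n) (hcond n) hg₁
    have e₀ := lintegral_mul_eq_of_condExp_eq (ℱ.le n) ((integrable_const 1).sub hyi) hy1
      (hpm.const_sub 1) (fun ω => sub_nonneg.2 (hp1 n ω)) hcond' hg₀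
    -- As `y n` is binary, the integrand is linear in `y n` with `ℱ n`-measurable coefficients, so
    -- `y n` may be replaced by `p n`.
    calc ∫⁻ ω in A, ENNReal.ofReal (M (n + 1) ω) ∂P
        = ∫⁻ ω, (ENNReal.ofReal (y n ω) * g₁ ω + ENNReal.ofReal (1 - y n ω) * g₀ ω) ∂P := by
          rw [← lintegral_indicator hA']
          refine lintegral_congr fun ω => ?_
          by_cases hω : ω ∈ A
          · rcases hbin n ω with h | h <;> simp [g₁, g₀, hω, h, hM]
          · simp [g₁, g₀, hω]
      _ = ∫⁻ ω, (ENNReal.ofReal (p n ω) * g₁ ω + ENNReal.ofReal (1 - p n ω) * g₀ ω) ∂P := by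
          rw [lintegral_add_left (f := fun ω => ENNReal.ofReal (y n ω) * g₁ ω)
            (hym.ennreal_ofReal.mul hg₁'), e₁,
            lintegral_add_left (f := fun ω => ENNReal.ofReal (p n ω) * g₁ ω)
            (hpm.ennreal_ofReal.mul hg₁')]
          congr 1
      _ ≤ ∫⁻ ω, A.indicator (fun ω => ENNReal.ofReal (M n ω)) ω ∂P := by
          refine lintegral_mono fun ω => ?_
          by_cases hω : ω ∈ A
          · have hp0' := hp0 n ω
            have hp1' := sub_nonneg.2 (hp1 n ω)
            have hf (c : ℝ) : 0 ≤ M n ω * mixtureFactor (v n ω) (μ n ω) c :=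
              mul_nonneg (hMnn n ω) (Real.exp_nonneg _)
            simp only [g₁, g₀, hω, Set.indicator_of_mem]
            rw [← ENNReal.ofReal_mul hp0', ← ENNReal.ofReal_mul hp1',
              ← ENNReal.ofReal_add (mul_nonneg hp0' (hf _)) (mul_nonneg hp1' (hf _))]
            refine ENNReal.ofReal_le_ofReal ?_
            have h := mul_le_mul_of_nonneg_left
              (bernoulli_mixtureFactor_le hp0' (hp1 n ω) (hv0 n ω) (μ n ω)) (hMnn n ω)
            linarith
          · simp [g₁, g₀, hω]
      _ = ∫⁻ ω in A, ENNReal.ofReal (M n ω) ∂P := lintegral_indicator hA' _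
  have hville := mul_measure_exists_le_lintegral (P := P) (ℱ := ℱ)
    (fun n => Measurable.ennreal_ofReal (hMm n)) hsuper (ENNReal.ofReal (1 / δ))
  simp only [hM0, ENNReal.ofReal_one, lintegral_const, measure_univ, mul_one] at hville
  have hset : {ω | ∃ n, ENNReal.ofReal (1 / δ) ≤ ENNReal.ofReal (M n ω)} =
      {ω | ∀ n, M n ω < 1 / δ}ᶜ := by
    ext ω
    simp only [Set.mem_ofPred_eq, Set.mem_compl_iff, not_forall, not_lt]
    exact exists_congr fun n => ENNReal.ofReal_le_ofReal_iff (hMnn n ω)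
  have hmeas : MeasurableSet {ω | ∀ n, M n ω < 1 / δ} := by
    rw [Set.ofPred_forall]
    exact MeasurableSet.iInter fun n =>
      measurableSet_lt ((hMm n).mono (ℱ.le n) le_rfl) measurable_const
  have hle : P {ω | ∀ n, M n ω < 1 / δ}ᶜ ≤ ENNReal.ofReal δ := by
    rw [hset, one_div, ENNReal.ofReal_inv_of_pos hδ, ← ENNReal.div_eq_inv_mul] at hville
    simpa using ENNReal.div_le_iff (by simpa using hδ) ENNReal.ofReal_ne_top |>.1 hville
  rw [ENNReal.ofReal_sub _ hδ.le, ENNReal.ofReal_one, tsub_le_iff_right,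
    ← prob_add_prob_compl (μ := P) hmeas]
  gcongr

end Maximal

/-! ### Self-normalized concentration in the RKHS -/

section SelfNormalized

variable {Z : Type*} {H : Type*} [NormedAddCommGroup H] [InnerProductSpace ℝ H] [CompleteSpace H]
  [RKHS ℝ H Z ℝ] {K : Z → Z → ℝ} {ρ : ℝ}

variable (H) in
/-- The accumulated noise `∑ i < n, ε i • K(z i, ·)`. -/
def noiseSum (z : ℕ → Z) (ε : ℕ → ℝ) (n : ℕ) : H := ∑ i : Fin n, ε i • feature H (z i)

variable (H) in
/-- The posterior mean at `z n` given the first `n` noise terms. -/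
def postMean (ρ : ℝ) (z : ℕ → Z) (ε : ℕ → ℝ) (n : ℕ) : ℝ :=
  ∑ i : Fin n, ε i * postCov H ρ z n (z n) (z i)

variable (H) in
/-- The mixture martingale, as a function of the points and the noise. -/
def mixture (ρ : ℝ) (z : ℕ → Z) (ε : ℕ → ℝ) (n : ℕ) : ℝ :=
  Real.exp (invCovNorm ρ (fun i : Fin n => z i) (noiseSum H z ε n) ^ 2 / 2 -
    1 / 2 * ∑ i ∈ Finset.range n, Real.log (1 + postCov H ρ z i (z i) (z i)))

/-- The finite sum `postMean` replaces the inner product so that its measurability follows from that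
of `postCov`. -/
lemma inner_inverse_noiseSum (z : ℕ → Z) (ε : ℕ → ℝ) (n : ℕ) :
    ⟪feature H (z n), (covSeq H ρ z n).inverse (noiseSum H z ε n)⟫ = postMean H ρ z ε n := by
  simp only [noiseSum, postMean, map_sum, map_smul, inner_sum, inner_smul_right]
  rfl

lemma mixture_zero (z : ℕ → Z) (ε : ℕ → ℝ) : mixture H ρ z ε 0 = 1 := by
  simp [mixture, noiseSum, invCovNorm]

/-- The rank-one update makes the quadratic form change by a function of three scalars: the new
noise, and the posterior mean and variance at the new point. -/
lemma mixture_succ (hρ : 0 < ρ) (z : ℕ → Z) (ε : ℕ → ℝ) (n : ℕ) :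
    mixture H ρ z ε (n + 1) = mixture H ρ z ε n *
      mixtureFactor (postCov H ρ z n (z n) (z n)) (postMean H ρ z ε n) (ε n) := by
  have hb : 0 < 1 + postCov H ρ z n (z n) (z n) := by
    linarith [postCov_self_nonneg (H := H) hρ z n (z n)]
  have hS : noiseSum H z ε (n + 1) = noiseSum H z ε n + ε n • feature H (z n) := by
    simp only [noiseSum, Fin.sum_univ_castSucc, Fin.val_castSucc, Fin.val_last]
  have hm := inner_inverse_noiseSum (H := H) (ρ := ρ) z ε n
  have hm' : ⟪noiseSum H z ε n, (covSeq H ρ z n).inverse (feature H (z n))⟫ =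
      postMean H ρ z ε n := by
    rw [← hm, covSeq, ← inner_inverse_symm hρ, real_inner_comm]
  have hv : ⟪feature H (z n), (covSeq H ρ z n).inverse (feature H (z n))⟫ =
      postCov H ρ z n (z n) (z n) := rfl
  have hQ : invCovNorm ρ (fun i : Fin (n + 1) => z i) (noiseSum H z ε (n + 1)) ^ 2 =
      invCovNorm ρ (fun i : Fin n => z i) (noiseSum H z ε n) ^ 2 +
        (postCov H ρ z n (z n) (z n) * ε n ^ 2 + 2 * postMean H ρ z ε n * ε n -
          postMean H ρ z ε n ^ 2) / (1 + postCov H ρ z n (z n) (z n)) := by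
    rw [sq_invCovNorm hρ, sq_invCovNorm hρ]
    change ⟪noiseSum H z ε (n + 1), (covSeq H ρ z (n + 1)).inverse _⟫ =
      ⟪noiseSum H z ε n, (covSeq H ρ z n).inverse _⟫ + _
    rw [covSeq_succ_inverse_apply hρ, hS]
    simp only [map_add, map_smul, inner_add_left, inner_add_right, inner_sub_right,
      inner_smul_left, inner_smul_right, hm, hm', hv, RCLike.conj_to_real]
    field_simp
    ring
  rw [mixture, mixture, mixtureFactor, ← Real.exp_add, hQ, Finset.sum_range_succ]
  congr 1
  field_simp
  ring

/-- Induction through `postCov_succ` avoids any measurable structure on the Hilbert space or its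
operators. -/
lemma measurable_postCov [MeasurableSpace Z] (hρ : 0 < ρ) (hK : IsRKHSOf H K)
    (hKm : Measurable (Function.uncurry K)) {Ω : Type*} {m : MeasurableSpace Ω} {z : ℕ → Ω → Z}
    {n : ℕ} (hz : ∀ i < n, Measurable (z i)) {u w : Ω → Z} (hu : Measurable u)
    (hw : Measurable w) :
    Measurable fun ω => postCov H ρ (fun i => z i ω) n (u ω) (w ω) := by
  induction n generalizing u w with
  | zero =>
    simp only [postCov_zero hρ hK]
    exact (hKm.comp (hu.prodMk hw)).div_const ρ
  | succ n ih =>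
    simp only [postCov_succ hρ]
    have hz' : ∀ i < n, Measurable (z i) := fun i hi => hz i (hi.trans (Nat.lt_succ_self n))
    have hn := hz n (Nat.lt_succ_self n)
    exact (ih hz' hu hw).sub (((ih hz' hu hn).mul (ih hz' hn hw)).div
      (measurable_const.add (ih hz' hn hn)))

lemma invCovNorm_le_of_mixture_lt [Nonempty Z] (hρ : 0 < ρ) (hK : IsRKHSOf H K) {C : ℝ}
    (hC : ∀ w, K w w ≤ C) {z : ℕ → Z} {ε : ℕ → ℝ} {n : ℕ} {δ : ℝ} (hδ : 0 < δ)
    (h : mixture H ρ z ε n < 1 / δ) :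
    invCovNorm ρ (fun i : Fin n => z i) (noiseSum H z ε n) ≤
      √(2 * (infoGain K ρ n + Real.log (1 / δ))) := by
  refine Real.le_sqrt_of_sq_le ?_
  have h1 := (Real.lt_log_iff_exp_lt (by positivity)).2 h
  have h2 := sum_log_le_infoGain hρ hK hC z n
  linarith

/-- The self-normalized concentration inequality for binary feedback in a reproducing kernel Hilbert
space. -/
lemma ofReal_le_measure_invCovNorm_noiseSum_le [Nonempty Z] [MeasurableSpace Z] (hρ : 0 < ρ)
    (hK : IsRKHSOf H K) (hKm : Measurable (Function.uncurry K)) {C : ℝ} (hC : ∀ w, K w w ≤ C)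
    {Ω : Type*} {mΩ : MeasurableSpace Ω} {P : Measure Ω} [IsProbabilityMeasure P]
    {ℱ : Filtration ℕ mΩ} {z : ℕ → Ω → Z} {y p : ℕ → Ω → ℝ}
    (hz : ∀ n, Measurable[ℱ n] (z n)) (hy : ∀ n, Measurable[ℱ (n + 1)] (y n))
    (hbin : ∀ n ω, y n ω = 0 ∨ y n ω = 1)
    (hp : ∀ n, Measurable[ℱ n] (p n)) (hp0 : ∀ n ω, 0 ≤ p n ω) (hp1 : ∀ n ω, p n ω ≤ 1)
    (hcond : ∀ n, P[y n | ℱ n] =ᵐ[P] p n) {δ : ℝ} (hδ : 0 < δ) :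
    ENNReal.ofReal (1 - δ) ≤ P {ω | ∀ n,
      invCovNorm ρ (fun i : Fin n => z i ω)
        (noiseSum H (fun i => z i ω) (fun i => y i ω - p i ω) n) ≤
        √(2 * (infoGain K ρ n + Real.log (1 / δ)))} := by
  have hzle {i n : ℕ} (h : i ≤ n) : Measurable[ℱ n] (z i) := (hz i).mono (ℱ.mono h) le_rfl
  refine (ofReal_le_measure_mixture_lt (ℱ := ℱ)
    (v := fun n ω => postCov H ρ (fun i => z i ω) n (z n ω) (z n ω))
    (μ := fun n ω => postMean H ρ (fun i => z i ω) (fun i => y i ω - p i ω) n)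
    (M := fun n ω => mixture H ρ (fun i => z i ω) (fun i => y i ω - p i ω) n)
    hy hbin hp hp0 hp1 hcond (fun n => ?_) (fun n ω => postCov_self_nonneg hρ _ _ _) (fun n => ?_)
    (fun ω => mixture_zero _ _) (fun n ω => mixture_succ hρ _ _ n) hδ).trans
    (measure_mono fun ω hω n => invCovNorm_le_of_mixture_lt hρ hK hC hδ (hω n))
  · exact measurable_postCov hρ hK hKm (fun i hi => hzle hi.le) (hz n) (hz n)
  · refine Finset.measurable_fun_sum _ fun i _ => Measurable.mul (Measurable.sub ?_ ?_) ?_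
    · exact (hy i).mono (ℱ.mono i.2) le_rfl
    · exact (hp i).mono (ℱ.mono i.2.le) le_rfl
    · exact measurable_postCov hρ hK hKm (fun j hj => hzle hj.le) (hz n) (hzle i.2.le)

end SelfNormalized

/-! ### Growth of the exploration coefficient and the elliptical potential -/

/-- `log(1 + x) / x` is decreasing, by Bernoulli's inequality with exponent `c / b`. -/
lemma mul_log_one_add_le {b c : ℝ} (hb : 0 ≤ b) (hbc : b ≤ c) :
    b * Real.log (1 + c) ≤ c * Real.log (1 + b) := by
  rcases hb.eq_or_lt with rfl | hb
  · simp
  have h := one_add_mul_self_le_rpow_one_add (show -1 ≤ b by linarith) ((one_le_div hb).2 hbc)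
  rw [div_mul_cancel₀ _ hb.ne'] at h
  have h2 := Real.log_le_log (by linarith) h
  rw [Real.log_rpow (by linarith), div_mul_eq_mul_div, le_div_iff₀ hb] at h2
  linarith

section Beta

variable {Z : Type*} {H : Type*} [NormedAddCommGroup H] [InnerProductSpace ℝ H] [CompleteSpace H]
  [RKHS ℝ H Z ℝ] {K : Z → Z → ℝ} {C lam B R δ : ℝ} [Nonempty Z]

omit [Nonempty Z] in
lemma beta_nonneg (hB : 0 ≤ B) (n : ℕ) : 0 ≤ beta K lam B R δ n := by
  have := lipConst_nonneg R
  unfold beta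
  positivity

lemma beta_mono (hlam : 0 < lam) (hR : 0 ≤ R) (hK : IsRKHSOf H K) (hC : ∀ w, K w w ≤ C) :
    Monotone (beta K lam B R δ) := by
  intro m n hmn
  have hκ : 0 < kappa R := by linarith [four_le_kappa hR]
  have h := infoGain_mono (mul_pos hlam hκ) hK hC hmn
  have hL := lipConst_nonneg R
  unfold beta
  gcongr

/-- `β_T ≤ A + D √γ_T`, and `γ_T ≥ γ_1 > 0` absorbs the constant `A` into `√γ_T`. If `γ_1 = 0` then
every `γ_T` vanishes and both sides are `0`. -/
lemma beta_isBigO (hlam : 0 < lam) (hR : 0 ≤ R) (hB : 0 ≤ B) (hK : IsRKHSOf H K)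
    (hC : ∀ w, K w w ≤ C) (c : ℝ) :
    (fun T : ℕ => c * beta K lam B R δ T * √((T : ℝ) * infoGain K (lam * kappa R) T))
      =O[atTop] fun T : ℕ => infoGain K (lam * kappa R) T * √(T : ℝ) := by
  have hκ : 0 < kappa R := by linarith [four_le_kappa hR]
  have hρ : 0 < lam * kappa R := mul_pos hlam hκ
  have hL := lipConst_nonneg R
  set γ := infoGain K (lam * kappa R) with hγ
  have hγ0 := infoGain_nonneg hρ hK hC
  rcases (hγ0 1).eq_or_lt with h1 | h1
  · have hzero (T : ℕ) : γ T = 0 := by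
      refine le_antisymm ?_ (hγ0 T)
      have := infoGain_le_mul hρ hK hC T
      rwa [← h1, mul_zero] at this
    simp only [hzero, mul_zero, Real.sqrt_zero, zero_mul]
    exact Asymptotics.isBigO_refl _ _
  set a := √(2 * kappa R / lam) with ha
  set l := √(|Real.log (1 / δ)|) with hl
  set A := 4 * lipConst R * B + 2 * lipConst R * (a * l) with hA
  have hA0 : 0 ≤ A := by positivity
  set D := 2 * lipConst R * a with hD
  have hD0 : 0 ≤ D := by positivity
  have hg1 : 0 < √(γ 1) := Real.sqrt_pos.2 h1
  refine Asymptotics.IsBigO.of_bound (|c| * (A / √(γ 1) + D)) ?_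
  filter_upwards [eventually_ge_atTop 1] with T hT
  have hγT : γ 1 ≤ γ T := infoGain_mono hρ hK hC hT
  have hg : √(γ 1) ≤ √(γ T) := Real.sqrt_le_sqrt hγT
  have hβ0 := beta_nonneg (K := K) (lam := lam) (R := R) (δ := δ) hB T
  have hβ : beta K lam B R δ T ≤ A + D * √(γ T) := by
    have h2 : √(2 * kappa R / lam * (γ T + Real.log (1 / δ))) ≤ a * (√(γ T) + l) := by
      rw [Real.sqrt_mul (by positivity)]
      refine mul_le_mul_of_nonneg_left ?_ (Real.sqrt_nonneg _)
      refine Real.sqrt_le_iff.2 ⟨by positivity, ?_⟩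
      have e1 := Real.sq_sqrt (hγ0 T)
      have e2 := Real.sq_sqrt (abs_nonneg (Real.log (1 / δ)))
      have e3 := le_abs_self (Real.log (1 / δ))
      have e4 : 0 ≤ √(γ T) * l := by positivity
      nlinarith
    have h3 := mul_le_mul_of_nonneg_left h2 (show 0 ≤ 2 * lipConst R by linarith)
    rw [beta, hA, hD]
    linarith
  have hkey : beta K lam B R δ T * √(γ T) ≤ (A / √(γ 1) + D) * γ T := by
    have h2 : A ≤ A / √(γ 1) * √(γ T) := by
      rw [div_mul_eq_mul_div, le_div_iff₀ hg1]
      exact mul_le_mul_of_nonneg_left hg hA0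
    calc beta K lam B R δ T * √(γ T) ≤ (A / √(γ 1) * √(γ T) + D * √(γ T)) * √(γ T) := by
          gcongr; linarith
      _ = (A / √(γ 1) + D) * (√(γ T) * √(γ T)) := by ring
      _ = _ := by rw [Real.mul_self_sqrt (hγ0 T)]
  rw [Real.sqrt_mul (Nat.cast_nonneg T), Real.norm_eq_abs, Real.norm_eq_abs, abs_mul, abs_mul,
    abs_of_nonneg hβ0, abs_of_nonneg (mul_nonneg (Real.sqrt_nonneg (T : ℝ)) (Real.sqrt_nonneg _)),
    abs_of_nonneg (mul_nonneg (hγ0 T) (Real.sqrt_nonneg _))]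
  calc |c| * beta K lam B R δ T * (√(T : ℝ) * √(γ T))
      = |c| * √(T : ℝ) * (beta K lam B R δ T * √(γ T)) := by ring
    _ ≤ |c| * √(T : ℝ) * ((A / √(γ 1) + D) * γ T) := by gcongr
    _ = _ := by ring

/-- The elliptical potential bound: the posterior widths along any sequence of points sum up to the
information gain. -/
lemma sum_posteriorStd_le {ρ : ℝ} (hρ : 0 < ρ) (hCpos : 0 < C) (hK : IsRKHSOf H K)
    (hC : ∀ w, K w w ≤ C) (z : ℕ → Z) (T : ℕ) :
    ∑ n ∈ Finset.range T, posteriorStd K ρ (fun i : Fin n => z i) (z n) ≤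
      √(2 * C / Real.log (1 + C * ρ⁻¹) * (T * infoGain K ρ T)) := by
  have hlog : 0 < Real.log (1 + C * ρ⁻¹) := Real.log_pos (by
    have : 0 < C * ρ⁻¹ := by positivity
    linarith)
  refine Real.le_sqrt_of_sq_le (sq_sum_le_card_mul_sum_sq.trans ?_)
  rw [Finset.card_range]
  have h1 : ∑ n ∈ Finset.range T, posteriorStd K ρ (fun i : Fin n => z i) (z n) ^ 2 ≤
      2 * C / Real.log (1 + C * ρ⁻¹) * infoGain K ρ T := by
    have h2 := sum_log_le_infoGain hρ hK hC z T
    -- The normalized variance lies in `[0, C / ρ]`, where it is at most a fixed multiple of `log(1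
    -- + ·)`.
    have h3 : ∀ n ∈ Finset.range T, posteriorStd K ρ (fun i : Fin n => z i) (z n) ^ 2 ≤
        C / Real.log (1 + C * ρ⁻¹) * Real.log (1 + postCov H ρ z n (z n) (z n)) := by
      intro n _
      rw [sq_posteriorStd hρ hK, div_mul_eq_mul_div, le_div_iff₀ hlog]
      have hb : postCov H ρ z n (z n) (z n) ≤ C * ρ⁻¹ :=
        (postCov_self_le hρ hK z n (z n)).trans (by
          rw [← div_eq_mul_inv]
          exact div_le_div_of_nonneg_right (hC _) hρ.le)
      have h4 := mul_le_mul_of_nonneg_left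
        (mul_log_one_add_le (postCov_self_nonneg (H := H) hρ z n (z n)) hb) hρ.le
      refine le_trans (le_of_eq (by ring)) (h4.trans (le_of_eq ?_))
      rw [mul_comm C, ← mul_assoc, mul_inv_cancel_left₀ hρ.ne']
    refine (Finset.sum_le_sum h3).trans ?_
    rw [← Finset.mul_sum]
    have h5 : 0 ≤ C / Real.log (1 + C * ρ⁻¹) := by positivity
    have h6 := mul_le_mul_of_nonneg_left h2 h5
    have h7 : 2 * C / Real.log (1 + C * ρ⁻¹) = 2 * (C / Real.log (1 + C * ρ⁻¹)) := by ring
    rw [h7]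
    linarith
  refine (mul_le_mul_of_nonneg_left h1 (Nat.cast_nonneg T)).trans (le_of_eq (by ring))

end Beta

/-! ### Regret of MaxMinLCB on the confidence event -/

section Regret

variable {X : Type*} {HD : Type*} [NormedAddCommGroup HD] [InnerProductSpace ℝ HD]
  [CompleteSpace HD] [RKHS ℝ HD (X × X) ℝ] {k : X → X → ℝ}

/-- Swapping a pair flips the sign of its feature, which a quadratic form ignores. -/
lemma posteriorStd_swap (ρ : ℝ) {n : ℕ} (hk : ∀ x y, k x y = k y x) (z : Fin n → X × X)
    (x x' : X) :
    posteriorStd (duelingKernel k) ρ z (x', x) = posteriorStd (duelingKernel k) ρ z (x, x') := by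
  have h1 : (fun i => duelingKernel k (z i) (x', x)) = -fun i => duelingKernel k (z i) (x, x') := by
    ext i
    simp only [duelingKernel, Pi.neg_apply]
    ring
  have h2 : duelingKernel k (x', x) (x', x) = duelingKernel k (x, x') (x, x') := by
    simp only [duelingKernel]
    rw [hk x x']
    ring
  rw [posteriorStd, posteriorStd, h1, h2, Matrix.mulVec_neg, neg_dotProduct_neg]

omit [CompleteSpace HD] in
/-- The regret of a round in which the confidence bounds of width `b σ` hold. -/
lemma IsStackelbergPair.regret_le {lam B b : ℝ} {n : ℕ} {z : Fin n → X × X} {h : HD} {f : X → ℝ}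
    {xs : X} {p : X × X} (hk : ∀ x y, k x y = k y x) (hxs : ∀ x, f x ≤ f xs)
    (hconf : ∀ x x', |Real.sigmoid (h (x, x')) - Real.sigmoid (f x - f x')| ≤
      width k lam B b z x x')
    (hp : IsStackelbergPair (lcb k lam B b z h) (plausibleSet k lam B b z h) p) :
    (Real.sigmoid (f xs - f p.1) + Real.sigmoid (f xs - f p.2) - 1) / 2 ≤
      3 * width k lam B b z p.1 p.2 := by
  obtain ⟨r, hr, hp1, -, hp2⟩ := hp
  have hxsM : xs ∈ plausibleSet k lam B b z h := by
    intro x'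
    have h1 : (1 : ℝ) / 2 ≤ Real.sigmoid (f xs - f x') := by
      have := Real.sigmoid_le (sub_nonneg.2 (hxs x'))
      rw [Real.sigmoid_zero] at this
      linarith
    linarith [(abs_le.1 (hconf xs x')).1]
  obtain ⟨hrM, hrmin⟩ := hr p.1 hp1
  rw [← hp2] at hrM hrmin
  have hswap : width k lam B b z p.2 p.1 = width k lam B b z p.1 p.2 := by
    rw [width, width, posteriorStd_swap _ hk]
  have hw0 : 0 ≤ width k lam B b z p.1 p.2 := (abs_nonneg _).trans (hconf p.1 p.2)
  -- The true probability that `p.1` beats `xs` is at least its lower bound, hence at least the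
  -- lower bound against the minimizer `p.2`, and plausibility of `p.1` puts that within two widths
  -- of `1/2`. The width at `(p.1, xs)` never enters.
  have ha : Real.sigmoid (f xs - f p.1) - 1 / 2 ≤ 2 * width k lam B b z p.1 p.2 := by
    have h1 : lcb k lam B b z h p.1 p.2 ≤ lcb k lam B b z h p.1 xs := hrmin hxsM
    have h2 := (abs_le.1 (hconf p.1 xs)).2
    have h3 := hp1 p.2
    have h4 : Real.sigmoid (f p.1 - f xs) = 1 - Real.sigmoid (f xs - f p.1) := by
      rw [← Real.sigmoid_neg, neg_sub]
    unfold lcb at h1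
    linarith
  -- Plausibility of `p.2`, tested against `p.1`.
  have hb : Real.sigmoid (f p.1 - f p.2) - 1 / 2 ≤ 2 * width k lam B b z p.1 p.2 := by
    have h1 := hrM p.1
    have h2 := (abs_le.1 (hconf p.2 p.1)).2
    have h4 : Real.sigmoid (f p.2 - f p.1) = 1 - Real.sigmoid (f p.1 - f p.2) := by
      rw [← Real.sigmoid_neg, neg_sub]
    rw [hswap] at h1 h2
    linarith
  have h := sigmoid_add_sigmoid_le (sub_nonneg.2 (hxs p.1)) (by linarith) ha hb
  rw [sub_add_sub_cancel] at h
  linarith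

/-- The parallelogram bound `‖a - b‖² ≤ 2 ‖a‖² + 2 ‖b‖²` for kernel sections. -/
lemma duelingKernel_diag_le (hk_le : ∀ x, k x x ≤ 1)
    {H : Type*} [NormedAddCommGroup H] [InnerProductSpace ℝ H] [CompleteSpace H] [RKHS ℝ H X ℝ]
    (hH : IsRKHSOf H k) (w : X × X) : duelingKernel k w w ≤ 4 := by
  have h0 : 0 ≤ ‖feature H w.1 + feature H w.2‖ ^ 2 := sq_nonneg _
  rw [← real_inner_self_eq_norm_sq, inner_add_left, inner_add_right, inner_add_right] at h0
  simp only [hH.inner_feature] at h0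
  have h1 := hk_le w.1
  have h2 := hk_le w.2
  simp only [duelingKernel]
  linarith

lemma abs_apply_le_of_norm_le {Z : Type*} {H : Type*} [NormedAddCommGroup H]
    [InnerProductSpace ℝ H] [CompleteSpace H] [RKHS ℝ H Z ℝ] {K : Z → Z → ℝ} (hK : IsRKHSOf H K)
    {r B : ℝ} (hr : 0 ≤ r) (hKr : ∀ w, K w w ≤ r ^ 2) {h : H} (hh : ‖h‖ ≤ B) (w : Z) :
    |h w| ≤ r * B := by
  have h1 : ‖feature H w‖ ≤ r := by
    refine le_of_sq_le_sq ?_ hr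
    rw [← real_inner_self_eq_norm_sq, hK.inner_feature]
    exact hKr w
  rw [← inner_feature_left]
  exact (abs_real_inner_le_norm _ _).trans (mul_le_mul h1 hh (norm_nonneg _) hr)

lemma duelingRegret_le [Nonempty X] {lam B δ : ℝ} (hlam : 0 < lam) (hB : 0 ≤ B)
    (hk : ∀ x y, k x y = k y x) (hHD : IsRKHSOf HD (duelingKernel k))
    (hC : ∀ w, duelingKernel k w w ≤ 4) {f : X → ℝ} {xs : X} (hxs : ∀ x, f x ≤ f xs) {hs : HD}
    (hsB : ‖hs‖ ≤ B) (hsf : ∀ x x', hs (x, x') = f x - f x') {x x' : ℕ → X} {y : ℕ → ℝ}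
    (halg : IsMaxMinLCB HD k lam B δ x x' y)
    (hnoise : ∀ n, invCovNorm (lam * kappaD B) (fun i : Fin n => (x i, x' i))
      (noiseSum HD (fun i => (x i, x' i)) (fun i => y i - Real.sigmoid (f (x i) - f (x' i))) n) ≤
        √(2 * (infoGain (duelingKernel k) (lam * kappaD B) n + Real.log (1 / δ)))) (T : ℕ) :
    duelingRegret f xs x x' T ≤
      C3 lam B * betaD k lam B δ T * √((T : ℝ) * gammaD k lam B T) := by
  have hR : 0 ≤ duelingRange B := by unfold duelingRange; linarith
  have hκ : 4 ≤ kappaD B := four_le_kappa hR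
  have hρ : 0 < lam * kappaD B := mul_pos hlam (by linarith)
  have hbd : ∀ h : HD, ‖h‖ ≤ B → ∀ w, |h w| ≤ duelingRange B := fun h hh w =>
    abs_apply_le_of_norm_le hHD (by norm_num) (fun w => (hC w).trans (by norm_num)) hh w
  have hβmono : Monotone (betaD k lam B δ) := beta_mono hlam hR hHD hC
  have hβ0 : ∀ n, 0 ≤ betaD k lam B δ n := beta_nonneg hB
  set σ : ℕ → ℝ := fun n => posteriorStd (duelingKernel k) (lam * kappaD B)
    (fun i : Fin n => (x i, x' i)) (x n, x' n) with hσ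
  have hround : ∀ n ∈ Finset.range T,
      (Real.sigmoid (f xs - f (x n)) + Real.sigmoid (f xs - f (x' n)) - 1) / 2 ≤
        3 * (betaD k lam B δ T * σ n) := by
    intro n hn
    obtain ⟨h, hest, hst⟩ := halg n
    have hconf (a a' : X) : |Real.sigmoid (h (a, a')) - Real.sigmoid (f a - f a')| ≤
        width k lam B (betaD k lam B δ (n + 1)) (fun i : Fin n => (x i, x' i)) a a' := by
      have h1 := hest.abs_sigmoid_sub_le_beta (K := duelingKernel k) (δ := δ) hlam hR hHD
        (z := fun i => (x i, x' i)) hbd hsB (by simp only [hsf]; exact hnoise n) (a, a')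
      rw [hsf] at h1
      -- The `n` observations give a bound with `β_n`, while round `n` plays with `β_{n+1}`;
      -- monotonicity bridges the two, and later replaces `β_{n+1}` by `β_T`.
      exact h1.trans (mul_le_mul_of_nonneg_right (hβmono (Nat.le_succ n))
        (posteriorStd_nonneg _ _ _ _))
    refine (hst.regret_le hk hxs hconf).trans ?_
    refine mul_le_mul_of_nonneg_left ?_ (by norm_num)
    exact mul_le_mul_of_nonneg_right (hβmono (Finset.mem_range.1 hn)) (posteriorStd_nonneg _ _ _ _)
  refine (Finset.sum_le_sum hround).trans ?_
  rw [← Finset.mul_sum, ← Finset.mul_sum]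
  have hsum := sum_posteriorStd_le hρ (by norm_num : (0 : ℝ) < 4) hHD hC
    (fun i => (x i, x' i)) T
  have hγ0 : 0 ≤ gammaD k lam B T := infoGain_nonneg hρ hHD hC T
  set ℓ := Real.log (1 + 4 * (lam * kappaD B)⁻¹) with hℓ
  have hℓ0 : 0 < ℓ := Real.log_pos (by
    have : 0 < 4 * (lam * kappaD B)⁻¹ := by positivity
    linarith)
  have hTγ : 0 ≤ (T : ℝ) * gammaD k lam B T := by positivity
  have hsqrt : √(2 * 4 / ℓ * (T * gammaD k lam B T)) ≤
      3 / √ℓ * √((T : ℝ) * gammaD k lam B T) := by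
    rw [Real.sqrt_mul' _ hTγ, Real.sqrt_div' _ hℓ0.le]
    have : √(2 * 4 : ℝ) ≤ 3 := Real.sqrt_le_iff.2 (by norm_num)
    gcongr
  have hsum' := hsum.trans hsqrt
  have hTβ := hβ0 T
  calc 3 * (betaD k lam B δ T * ∑ n ∈ Finset.range T, σ n)
      ≤ 3 * (betaD k lam B δ T * (3 / √ℓ * √((T : ℝ) * gammaD k lam B T))) := by gcongr
    _ = 9 / √ℓ * betaD k lam B δ T * √((T : ℝ) * gammaD k lam B T) := by ring
    -- `9 ≤ 8 + 2 κ` because `κ ≥ 4`; the `9` is three widths per round times the rounding `√8 ≤ 3`.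
    _ ≤ C3 lam B * betaD k lam B δ T * √((T : ℝ) * gammaD k lam B T) := by
      unfold C3
      gcongr
      linarith

end Regret

end

end DuelingBandit

/-! ### The main theorem -/

theorem mainTheorem1 {d : ℕ} (X : Set (EuclideanSpace ℝ (Fin d))) (hX : IsCompact X)
    (k : X → X → ℝ) (hk_meas : Measurable (Function.uncurry k)) (hk_le : ∀ x, k x x ≤ 1)
    {H : Type*} [NormedAddCommGroup H] [InnerProductSpace ℝ H] [CompleteSpace H] [RKHS ℝ H X ℝ]
    (hH : DuelingBandit.IsRKHSOf H k)
    {HD : Type*} [NormedAddCommGroup HD] [InnerProductSpace ℝ HD] [CompleteSpace HD]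
    [RKHS ℝ HD (X × X) ℝ]
    (hHD : DuelingBandit.IsRKHSOf HD (DuelingBandit.duelingKernel k))
    (hk_mean : DuelingBandit.ZeroMeanEigenfunctions
      (MeasureTheory.Measure.comap (Subtype.val : X → EuclideanSpace ℝ (Fin d))
        MeasureTheory.volume) k)
    (f : H) (B : ℝ) (hf : ‖f‖ ≤ B)
    (xs : X) (hxs : ∀ x : X, f x ≤ f xs)
    (lam : ℝ) (hlam : 0 < lam) (δ : ℝ) (hδ_pos : 0 < δ) (hδ_le : δ ≤ 1)
    {Ω : Type*} {mΩ : MeasurableSpace Ω} (P : MeasureTheory.Measure Ω)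
    [MeasureTheory.IsProbabilityMeasure P] (ℱ : MeasureTheory.Filtration ℕ mΩ)
    (x x' : ℕ → Ω → X) (y : ℕ → Ω → ℝ)
    (hfeedback : DuelingBandit.IsPreferenceFeedback P ℱ (fun a : X => f a) x x' y)
    (halg : ∀ ω, DuelingBandit.IsMaxMinLCB HD k lam B δ
      (fun n => x n ω) (fun n => x' n ω) (fun n => y n ω)) :
    ENNReal.ofReal (1 - δ) ≤
        P {ω | ∀ T : ℕ,
          DuelingBandit.duelingRegret (fun a : X => f a) xs (fun n => x n ω) (fun n => x' n ω) T ≤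
            DuelingBandit.C3 lam B * DuelingBandit.betaD k lam B δ T *
              √((T : ℝ) * DuelingBandit.gammaD k lam B T)} ∧
      (fun T : ℕ => DuelingBandit.C3 lam B * DuelingBandit.betaD k lam B δ T *
          √((T : ℝ) * DuelingBandit.gammaD k lam B T))
        =O[Filter.atTop] (fun T : ℕ => DuelingBandit.gammaD k lam B T * √(T : ℝ)) := by
  have hne : Nonempty X := ⟨xs⟩
  have hB : 0 ≤ B := (norm_nonneg f).trans hf
  have hR : 0 ≤ DuelingBandit.duelingRange B := by unfold DuelingBandit.duelingRange; linarith
  have hκ : 4 ≤ DuelingBandit.kappaD B := DuelingBandit.four_le_kappa hR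
  have hρ : 0 < lam * DuelingBandit.kappaD B := mul_pos hlam (by linarith)
  have hC := DuelingBandit.duelingKernel_diag_le hk_le hH
  refine ⟨?_, DuelingBandit.beta_isBigO hlam hR hB hHD hC _⟩
  obtain ⟨hs, hsf_norm, hsf⟩ := DuelingBandit.exists_dueling_difference hH hHD f
  have hfm : Measurable fun a : X => f a := hH.measurable_coe hk_meas f
  have hKm : Measurable (Function.uncurry (DuelingBandit.duelingKernel k)) := by
    have hcomp {u v : (X × X) × (X × X) → X} (hu : Measurable u) (hv : Measurable v) :
        Measurable fun q => k (u q) (v q) := hk_meas.comp (hu.prodMk hv)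
    exact (((hcomp (measurable_fst.comp measurable_fst) (measurable_fst.comp measurable_snd)).add
      (hcomp (measurable_snd.comp measurable_fst) (measurable_snd.comp measurable_snd))).sub
      (hcomp (measurable_fst.comp measurable_fst) (measurable_snd.comp measurable_snd))).sub
      (hcomp (measurable_snd.comp measurable_fst) (measurable_fst.comp measurable_snd))
  -- The noise event is contained in the regret event, pathwise and for every horizon, so
  -- monotonicity of `P` suffices without measurability of the latter.
  refine (DuelingBandit.ofReal_le_measure_invCovNorm_noiseSum_le hρ hHD hKm hC (ℱ := ℱ)
    (z := fun n ω => (x n ω, x' n ω)) (y := y)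
    (p := fun n ω => Real.sigmoid (f (x n ω) - f (x' n ω)))
    (fun n => Measurable.prodMk (hfeedback.measurable_fst n) (hfeedback.measurable_snd n))
    hfeedback.measurable_feedback hfeedback.binary
    (fun n => continuous_sigmoid.measurable.comp
      (Measurable.sub (hfm.comp (hfeedback.measurable_fst n))
        (hfm.comp (hfeedback.measurable_snd n))))
    (fun n ω => Real.sigmoid_nonneg _) (fun n ω => Real.sigmoid_le_one _)
    hfeedback.prob_eq hδ_pos).trans (MeasureTheory.measure_mono fun ω hω T => ?_)
  exact DuelingBandit.duelingRegret_le hlam hB hH.symm hHD hC hxs (hsf_norm.trans hf) hsf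
    (halg ω) hω T
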